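/- For a matrix $A\in\mathbb{R}^{n\times m}$ let $\|A\|_\infty$ be the largest $\ell_1$ norm of a row and $\mathrm{nnz}(A)$ the number of nonzero entries. Assume $n\ge 1$, $\mathrm{nnz}(A)\ge n$, that every column of $A$ has at most $c$ nonzero entries, and let $b\in\mathbb{R}^n$, $r>0$, $\epsilon>0$. The model of computation is a randomized real RAM (unit-cost exact real arithmetic including $\exp$ and $\log$, comparisons, array access, and uniform random reals in $[0,1]$); $A$ is given in compressed sparse column format. "In time $\tilde O(f)$" means: within $C f\log^k(2+f)$ steps on every outcome of the random bits, and "with high probability" means: with probability at least $1-(n+m)^{-K}$, where $K\in\mathbb{N}$ is any fixed constant, and the program and $C,k$ depend only on $K$. (1) There is an algorithm which, given $A,b,r,\epsilon$, finds with high probability an $\epsilon$-approximate minimizer of the box-constrained $\ell_\infty$ regression problem $\min_{x\in[-r,r]^m}\|Ax-b\|_\infty$, i.e. a point $x\in[-r,r]^m$ with $\|Ax-b\|_\infty\le\min_{y\in[-r,r]^m}\|Ay-b\|_\infty+\epsilon$, in time $$\tilde O\bigl(mc\cdot\max(1,\,r\|A\|_\infty/\epsilon)\bigr);$$ for $\epsilon\le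 r\|A\|_\infty$ this is $\tilde O(mcr\|A\|_\infty/\epsilon)$. (2) There is an algorithm which, given $A,b,r,\epsilon$ and a point $x_0\in\mathbb{R}^m$ such that $\|x_0-x^*\|_\infty\le r$ for some minimizer $x^*$ of $\|Ax-b\|_\infty$ over $\mathbb{R}^m$, finds with high probability a point $x\in\mathbb{R}^m$ with $\|Ax-b\|_\infty\le\|Ax^*-b\|_\infty+\epsilon$ within the same time bound. -/

import Mathlib

open MeasureTheory
open scoped Matrix

-- On matrices, `‖A‖` is the operator norm induced by the sup norm: the largest ℓ₁ norm of a row.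
attribute [local instance] Matrix.linftyOpNormedAddCommGroup

namespace LinfReg

/-! ### A randomized real RAM

Programs work on natural-number and real variables and on finitely many named arrays of either
kind (names are numerals fixed in the program text; array indices are computed at run time).
Every arithmetic operation, comparison, memory access, coin toss and control transfer costs one
unit of time.  Real arithmetic is exact and comprises field operations, `exp` and `log`; there is
no rounding from reals to naturals, and the only numerals are natural numbers. -/

/-- Memory of the machine, with the supply of independent random reals in `[0,1]`. -/
structure State where
  nvar : ℕ → ℕ
  rvar : ℕ → ℝ
  narr : ℕ → ℕ → ℕ
  rarr : ℕ → ℕ → ℝ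
  coins : ℕ → unitInterval

/-- Expressions of natural-number type. -/
inductive NExp where
  | lit (k : ℕ)
  | var (a : ℕ)
  | get (a : ℕ) (i : NExp)
  | add (e f : NExp)
  | sub (e f : NExp)
  | half (e : NExp)

/-- Truncated subtraction and halving with rounding down. -/
def NExp.eval (s : State) : NExp → ℕ
  | lit k => k
  | var a => s.nvar a
  | get a i => s.narr a (i.eval s)
  | add e f => e.eval s + f.eval s
  | sub e f => e.eval s - f.eval s
  | half e => e.eval s / 2

/-- Number of elementary operations needed to evaluate an expression. -/
def NExp.cost : NExp → ℕ
  | lit _ => 1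
  | var _ => 1
  | get _ i => i.cost + 1
  | add e f => e.cost + f.cost + 1
  | sub e f => e.cost + f.cost + 1
  | half e => e.cost + 1

/-- Expressions of real type. -/
inductive RExp where
  | ofNat (e : NExp)
  | var (a : ℕ)
  | get (a : ℕ) (i : NExp)
  | add (e f : RExp)
  | sub (e f : RExp)
  | mul (e f : RExp)
  | div (e f : RExp)
  | exp (e : RExp)
  | log (e : RExp)

/-- Undefined quotients and logarithms return the default values of Lean's functions; a program
can test for these cases beforehand. -/
noncomputable def RExp.eval (s : State) : RExp → ℝ
  | ofNat e => (e.eval s : ℝ)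
  | var a => s.rvar a
  | get a i => s.rarr a (i.eval s)
  | add e f => e.eval s + f.eval s
  | sub e f => e.eval s - f.eval s
  | mul e f => e.eval s * f.eval s
  | div e f => e.eval s / f.eval s
  | exp e => Real.exp (e.eval s)
  | log e => Real.log (e.eval s)

/-- Number of elementary operations needed to evaluate an expression. -/
def RExp.cost : RExp → ℕ
  | ofNat e => e.cost + 1
  | var _ => 1
  | get _ i => i.cost + 1
  | add e f => e.cost + f.cost + 1
  | sub e f => e.cost + f.cost + 1
  | mul e f => e.cost + f.cost + 1
  | div e f => e.cost + f.cost + 1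
  | exp e => e.cost + 1
  | log e => e.cost + 1

/-- Tests. -/
inductive Test where
  | nlt (e f : NExp)
  | rlt (e f : RExp)
  | not (t : Test)
  | and (t u : Test)

def Test.Holds (s : State) : Test → Prop
  | nlt e f => e.eval s < f.eval s
  | rlt e f => e.eval s < f.eval s
  | not t => ¬ t.Holds s
  | and t u => t.Holds s ∧ u.Holds s

/-- Number of elementary operations needed to evaluate a test. -/
def Test.cost : Test → ℕ
  | nlt e f => e.cost + f.cost + 1
  | rlt e f => e.cost + f.cost + 1
  | not t => t.cost + 1
  | and t u => t.cost + u.cost + 1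

/-- Programs. -/
inductive Prog where
  | skip
  | nset (a : ℕ) (e : NExp)
  | rset (a : ℕ) (e : RExp)
  | nput (a : ℕ) (i : NExp) (e : NExp)
  | rput (a : ℕ) (i : NExp) (e : RExp)
  | toss (a : ℕ)
  | seq (p q : Prog)
  | ite (t : Test) (p q : Prog)
  | loop (t : Test) (p : Prog)

/-- Store a value in a variable or in an array cell. -/
def State.nset (s : State) (a v : ℕ) : State :=
  { s with nvar := Function.update s.nvar a v }

def State.rset (s : State) (a : ℕ) (v : ℝ) : State :=
  { s with rvar := Function.update s.rvar a v }

def State.nput (s : State) (a i v : ℕ) : State :=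
  { s with narr := Function.update s.narr a (Function.update (s.narr a) i v) }

def State.rput (s : State) (a i : ℕ) (v : ℝ) : State :=
  { s with rarr := Function.update s.rarr a (Function.update (s.rarr a) i v) }

/-- Store the next random real in a variable. -/
def State.toss (s : State) (a : ℕ) : State :=
  { s.rset a (s.coins 0 : ℝ) with coins := fun k => s.coins (k + 1) }

/-- `Exec p s s' T`: program `p`, started in `s`, halts in `s'` after `T` units of time. -/
inductive Exec : Prog → State → State → ℕ → Prop where
  | skip (s : State) : Exec .skip s s 1
  | nset (s : State) (a : ℕ) (e : NExp) :
      Exec (.nset a e) s (s.nset a (e.eval s)) (e.cost + 1)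
  | rset (s : State) (a : ℕ) (e : RExp) :
      Exec (.rset a e) s (s.rset a (e.eval s)) (e.cost + 1)
  | nput (s : State) (a : ℕ) (i e : NExp) :
      Exec (.nput a i e) s (s.nput a (i.eval s) (e.eval s)) (i.cost + e.cost + 1)
  | rput (s : State) (a : ℕ) (i : NExp) (e : RExp) :
      Exec (.rput a i e) s (s.rput a (i.eval s) (e.eval s)) (i.cost + e.cost + 1)
  | toss (s : State) (a : ℕ) : Exec (.toss a) s (s.toss a) 1
  | seq {p q : Prog} {s s' s'' : State} {T U : ℕ} :
      Exec p s s' T → Exec q s' s'' U → Exec (.seq p q) s s'' (T + U)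
  | ite_true {t : Test} {p q : Prog} {s s' : State} {T : ℕ} :
      t.Holds s → Exec p s s' T → Exec (.ite t p q) s s' (t.cost + T + 1)
  | ite_false {t : Test} {p q : Prog} {s s' : State} {T : ℕ} :
      ¬ t.Holds s → Exec q s s' T → Exec (.ite t p q) s s' (t.cost + T + 1)
  | loop_true {t : Test} {p : Prog} {s s' s'' : State} {T U : ℕ} :
      t.Holds s → Exec p s s' T → Exec (.loop t p) s' s'' U →
        Exec (.loop t p) s s'' (t.cost + T + U + 1)
  | loop_false {t : Test} {p : Prog} {s : State} :
      ¬ t.Holds s → Exec (.loop t p) s s (t.cost + 1)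

/-- Independent uniform random reals in `[0,1]`. -/
noncomputable def coinMeasure : Measure (ℕ → unitInterval) :=
  Measure.infinitePi fun _ => (volume : Measure unitInterval)

/-- On every outcome of the coins, `p` halts within time `T`; and the outcomes for which its final
state is not `Good` have probability at most `δ`. -/
def SolvesWithin (p : Prog) (init : (ℕ → unitInterval) → State) (T : ℝ) (δ : ENNReal)
    (Good : State → Prop) : Prop :=
  (∀ ω, ∃ s' t, Exec p (init ω) s' t ∧ (t : ℝ) ≤ T) ∧
    coinMeasure {ω | ¬ ∃ s' t, Exec p (init ω) s' t ∧ Good s'} ≤ δ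

/-- The bound `C · f · logᵏ f` of soft-O notation (`2 + f` keeps the logarithm away from `0`). -/
noncomputable def softBound (C : ℝ) (k : ℕ) (f : ℝ) : ℝ := C * f * Real.log (2 + f) ^ k

/-! ### Input and output -/

/-- Number of nonzero entries of column `j`. -/
noncomputable def colNnz {n m : ℕ} (A : Matrix (Fin n) (Fin m) ℝ) (j : Fin m) : ℕ :=
  {i : Fin n | A i j ≠ 0}.ncard

/-- Number of nonzero entries. -/
noncomputable def nnz {n m : ℕ} (A : Matrix (Fin n) (Fin m) ℝ) : ℕ :=
  ∑ j, colNnz A j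

/-- Compressed sparse column format: the nonzero entries of column `j`, in any order and each
once, occupy the positions `colPtr j ≤ k < colPtr (j + 1)`. -/
structure CSC {n m : ℕ} (A : Matrix (Fin n) (Fin m) ℝ) where
  colPtr : ℕ → ℕ
  rowIdx : ℕ → ℕ
  val : ℕ → ℝ
  colPtr_zero : colPtr 0 = 0
  colPtr_le : ∀ j : Fin m, colPtr j ≤ colPtr (j + 1)
  sound : ∀ (j : Fin m) (k : ℕ), colPtr j ≤ k → k < colPtr (j + 1) →
    ∃ i : Fin n, rowIdx k = i ∧ val k = A i j ∧ A i j ≠ 0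
  complete : ∀ (j : Fin m) (i : Fin n), A i j ≠ 0 →
    ∃! k : ℕ, colPtr j ≤ k ∧ k < colPtr (j + 1) ∧ rowIdx k = i

/-- A vector as the beginning of an array, followed by zeros. -/
def pad {d : ℕ} (v : Fin d → ℝ) (i : ℕ) : ℝ := if h : i < d then v ⟨i, h⟩ else 0

/-- Initial memory: the dimensions, the scalars `r` and `ε`, the sparse matrix, `b` and a point
`x₀` in the first variables and arrays of their kind; everything else is zero. -/
noncomputable def initState {n m : ℕ} {A : Matrix (Fin n) (Fin m) ℝ} (D : CSC A)
    (b : Fin n → ℝ) (r ε : ℝ) (x₀ : Fin m → ℝ) (ω : ℕ → unitInterval) : State where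
  nvar
    | 0 => n
    | 1 => m
    | _ => 0
  rvar
    | 0 => r
    | 1 => ε
    | _ => 0
  narr
    | 0 => D.colPtr
    | 1 => D.rowIdx
    | _ => fun _ => 0
  rarr
    | 0 => D.val
    | 1 => pad b
    | 2 => pad x₀
    | _ => fun _ => 0
  coins := ω

/-- The result is read off from the first `m` cells of real array number `3`. -/
def output (m : ℕ) (s : State) : Fin m → ℝ := fun j => s.rarr 3 j

/-- `x` is a point of `S` where `f` is within `ε` of its minimum over `S`. -/
def IsApproxMin {X : Type*} (f : X → ℝ) (S : Set X) (ε : ℝ) (x : X) : Prop :=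
  x ∈ S ∧ ∀ y ∈ S, f x ≤ f y + ε

end LinfReg

namespace LinfReg

/-! ### A first-order method for box-simplex games -/

section Game

variable {I J : Type*} [Fintype J]

/-! After translating by `x₀` and scaling by `r * ‖A‖`, the problem is to minimize `‖B *ᵥ u - b'‖`
over the box `|u j| ≤ 1`, where every row of `B` has ℓ₁ norm at most `1`. With `M` the rows of `B`
and of `-B`, and `d` the corresponding offsets, this is a game: a box player minimizes and a simplex
player maximizes `y ⬝ᵥ (M *ᵥ x + d)`.

The regularizer `reg`, that is `y ⬝ᵥ |M| x² + 120 ∑ y log y`, couples the two players. Its quadratic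
part has size at most `1` whatever the dimension of the box, yet it controls the movement of `x` in
every row, because the square of `|M| |x|` is at most `|M| x²` (`sq_absMat_mulVec_le`). The only
other cost is the range of the entropy, so the error after `T` rounds is `O((1 + log n) / T)`.

The method `play` is optimistic dual averaging: each player answers the accumulated payoffs plus the
opponent's last strategy, taken as a guess of the next one. In the `x`-step the weights `y` of the
quadratic part are frozen, so the step splits into one-dimensional quadratics; the `y`-step is then
a softmax. `alternating_lower_bound` is the optimality inequality of such a step, with a defect
caused by the freezing. `variation_progress` absorbs this defect and the errors of the guesses into
the curvature and a telescoping term, `potential_ge` sums over the rounds, and `play_gap` evaluates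
the result at a point of the box and a single row. `regression_gap` and `regression_solution`
translate back.

The rest implements the method. `Run` is a program logic with time bounds. A round costs `O(n + m +
nnz A)`, which is `O(m c)`, and `rounds` is of order `(1 + log n) r ‖A‖ / ε`, up to rounding. The
program `solver` tosses no coins, so its failure event is empty. It serves both statements: the box
is centred at `0` for the first, and for the second the box around `x₀` contains a global minimizer.
-/

/-- Projection of a real number to `[-1,1]`. -/
noncomputable def clip (t : ℝ) : ℝ := max (-1) (min t 1)

theorem abs_clip_le (t : ℝ) : |clip t| ≤ 1 :=
  abs_le.2 ⟨le_max_left _ _, max_le (by norm_num) (min_le_right _ _)⟩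

/-- `clip (-p / (2 w))` minimizes `p x + w x²` over `[-1,1]`: the first-order condition.
If `w = 0`, every point of the interval is a minimizer, and the value of the quotient is
irrelevant. -/
theorem clip_optimal {p w x : ℝ} (hw : 0 ≤ w) (hp : w = 0 → p = 0) (hx : |x| ≤ 1) :
    0 ≤ (p + 2 * w * clip (-p / (2 * w))) * (x - clip (-p / (2 * w))) := by
  rcases hw.eq_or_lt with h | h
  · simp [← h, hp h.symm]
  obtain ⟨h1, h2⟩ := abs_le.1 hx
  have hv : p = -(2 * w * (-p / (2 * w))) := by field_simp
  generalize -p / (2 * w) = v at *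
  have : (p + 2 * w * clip v) * (x - clip v) = 2 * w * ((clip v - v) * (x - clip v)) := by
    rw [hv]; ring
  rw [this]
  refine mul_nonneg (by positivity) ?_
  unfold clip
  rcases le_total v 1 with h3 | h3
  · rw [min_eq_left h3]
    rcases le_total (-1) v with h4 | h4
    · simp [max_eq_right h4]
    · rw [max_eq_left h4]; exact mul_nonneg (by linarith) (by linarith)
  · rw [min_eq_right h3, max_eq_right (by norm_num)]
    exact mul_nonneg_of_nonpos_of_nonpos (by linarith) (by linarith)

/-- Absolute values of the entries. -/
def absMat (M : Matrix I J ℝ) : Matrix I J ℝ := fun i j => |M i j|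

theorem abs_mulVec_le {M : Matrix I J ℝ} (hM : ∀ i, ∑ j, |M i j| ≤ 1) {x : J → ℝ} {c : ℝ}
    (hc : 0 ≤ c) (hx : ∀ j, |x j| ≤ c) (i : I) : |(M *ᵥ x) i| ≤ c := by
  refine (Finset.abs_sum_le_sum_abs _ _).trans ?_
  calc ∑ j, |M i j * x j| ≤ ∑ j, |M i j| * c :=
        Finset.sum_le_sum fun j _ => by rw [abs_mul]; gcongr; exact hx j
    _ ≤ c := by rw [← Finset.sum_mul]; exact mul_le_of_le_one_left hc (hM i)

theorem absMat_row_le {M : Matrix I J ℝ} (hM : ∀ i, ∑ j, |M i j| ≤ 1) (i : I) :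
    ∑ j, |absMat M i j| ≤ 1 := by simpa [absMat] using hM i

theorem absMat_mulVec_nonneg (M : Matrix I J ℝ) {x : J → ℝ} (hx : ∀ j, 0 ≤ x j) (i : I) :
    0 ≤ (absMat M *ᵥ x) i :=
  Finset.sum_nonneg fun j _ => mul_nonneg (abs_nonneg _) (hx j)

theorem abs_mulVec_le_absMat (M : Matrix I J ℝ) (x : J → ℝ) (i : I) :
    |(M *ᵥ x) i| ≤ (absMat M *ᵥ |x|) i := by
  refine (Finset.abs_sum_le_sum_abs _ _).trans (le_of_eq ?_)
  exact Finset.sum_congr rfl fun j _ => abs_mul _ _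

/-- Cauchy–Schwarz with the weights `|M i j|`, whose total is at most `1`. This lets the quadratic
part of the regularizer pay for bilinear errors without a factor depending on the number of columns.
-/
theorem sq_absMat_mulVec_le {M : Matrix I J ℝ} (hM : ∀ i, ∑ j, |M i j| ≤ 1) (x : J → ℝ) (i : I) :
    (absMat M *ᵥ |x|) i ^ 2 ≤ (absMat M *ᵥ (x * x)) i := by
  have h := Finset.sum_sq_le_sum_mul_sum_of_sq_le_mul Finset.univ
    (r := fun j => |M i j| * |x j|) (f := fun j => |M i j|) (g := fun j => |M i j| * (x j * x j))
    (fun j _ => abs_nonneg _) (fun j _ => mul_nonneg (abs_nonneg _) (mul_self_nonneg _))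
    (fun j _ => by rw [mul_pow, sq_abs (x j)]; exact le_of_eq (by ring))
  refine h.trans (mul_le_of_le_one_left ?_ (hM i))
  exact Finset.sum_nonneg fun j _ => mul_nonneg (abs_nonneg _) (mul_self_nonneg _)

/-! ### Gibbs distributions and relative entropy -/

variable [Fintype I]

/-- The Gibbs distribution with logits `f`. -/
noncomputable def softmax (f : I → ℝ) (i : I) : ℝ := Real.exp (f i) / ∑ k, Real.exp (f k)

theorem sum_exp_pos [Nonempty I] (f : I → ℝ) : 0 < ∑ k, Real.exp (f k) :=
  Finset.sum_pos (fun _ _ => Real.exp_pos _) Finset.univ_nonempty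

theorem softmax_pos [Nonempty I] (f : I → ℝ) (i : I) : 0 < softmax f i :=
  div_pos (Real.exp_pos _) (sum_exp_pos f)

theorem sum_softmax [Nonempty I] (f : I → ℝ) : ∑ i, softmax f i = 1 := by
  simp only [softmax, ← Finset.sum_div]
  exact div_self (sum_exp_pos f).ne'

theorem log_softmax [Nonempty I] (f : I → ℝ) (i : I) :
    Real.log (softmax f i) = f i - Real.log (∑ k, Real.exp (f k)) := by
  rw [softmax, Real.log_div (Real.exp_pos _).ne' (sum_exp_pos f).ne', Real.log_exp]

/-- Numerator and normalizer each change by a factor of at most `exp (1 / 20)`, and `exp (1 / 10) ≤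
1 / (1 - 1 / 10)`. -/
theorem softmax_le_two_mul [Nonempty I] {f g : I → ℝ} (h : ∀ i, |f i - g i| ≤ 1 / 20) (i : I) :
    softmax f i ≤ 2 * softmax g i := by
  have h1 : Real.exp (f i) ≤ Real.exp (1 / 20) * Real.exp (g i) := by
    rw [← Real.exp_add]; exact Real.exp_le_exp.2 (by linarith [(abs_le.1 (h i)).2])
  have h2 : ∑ k, Real.exp (g k) ≤ Real.exp (1 / 20) * ∑ k, Real.exp (f k) := by
    rw [Finset.mul_sum]
    refine Finset.sum_le_sum fun k _ => ?_
    rw [← Real.exp_add]; exact Real.exp_le_exp.2 (by linarith [(abs_le.1 (h k)).1])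
  have h3 : Real.exp (1 / 20) * Real.exp (1 / 20) ≤ 2 := by
    rw [← Real.exp_add]
    have := Real.exp_bound_div_one_sub_of_interval (x := 1 / 10) (by norm_num) (by norm_num)
    norm_num at this ⊢; linarith
  have hf := sum_exp_pos f
  have hg := sum_exp_pos g
  have := Real.exp_pos (g i)
  unfold softmax
  rw [← mul_div_assoc, div_le_div_iff₀ hf hg]
  calc Real.exp (f i) * ∑ k, Real.exp (g k)
      ≤ (Real.exp (1 / 20) * Real.exp (g i)) * (Real.exp (1 / 20) * ∑ k, Real.exp (f k)) := by
        gcongr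
    _ = (Real.exp (1 / 20) * Real.exp (1 / 20)) * (Real.exp (g i) * ∑ k, Real.exp (f k)) := by ring
    _ ≤ 2 * (Real.exp (g i) * ∑ k, Real.exp (f k)) := by gcongr
    _ = _ := by ring

/-- The relative entropy of a pair of numbers dominates their squared Hellinger distance. -/
theorem sq_sqrt_sub_le {a b : ℝ} (ha : 0 ≤ a) (hb : 0 < b) :
    (√a - √b) ^ 2 ≤ a * Real.log a - a * Real.log b - a + b := by
  rcases ha.eq_or_lt with rfl | ha
  · simp [Real.sq_sqrt hb.le]
  -- Applying the inequality to the square root, not to `b / a`, produces the term `2 √a √b` of the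
  -- Hellinger distance.
  have h := Real.log_le_sub_one_of_pos (x := √(b / a)) (by positivity)
  rw [Real.log_sqrt (by positivity), Real.log_div hb.ne' ha.ne', Real.sqrt_div hb.le] at h
  have h2 := Real.sq_sqrt ha.le
  have h3 := Real.sq_sqrt hb.le
  have h4 : 0 < √a := Real.sqrt_pos.2 ha
  have h5 : a * (√b / √a) = √a * √b := by field_simp; rw [h2]
  nlinarith

theorem entropy_nonneg {a b : ℝ} (ha : 0 ≤ a) (hb : 0 < b) :
    a - b ≤ a * Real.log a - a * Real.log b := by
  linarith [sq_sqrt_sub_le ha hb, sq_nonneg (√a - √b)]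

/-- Factor `a - b` as `(√a - √b) (√a + √b)`. The first factor is controlled by the entropy, and the
square of the second is at most `2 (a + b) ≤ 6 a`. -/
theorem sq_sub_div_le_entropy {a b : ℝ} (ha : 0 < a) (hb : 0 < b) (h : b ≤ 2 * a) :
    (a - b) ^ 2 / a ≤ 6 * (a * Real.log a - a * Real.log b - a + b) := by
  refine le_trans ?_ (mul_le_mul_of_nonneg_left (sq_sqrt_sub_le ha.le hb) (by norm_num))
  have h2 := Real.sq_sqrt ha.le
  have h3 := Real.sq_sqrt hb.le
  have e : (a - b) ^ 2 = (√a - √b) ^ 2 * (√a + √b) ^ 2 := by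
    rw [← mul_pow, show (√a - √b) * (√a + √b) = √a ^ 2 - √b ^ 2 by ring, h2, h3]
  have h6 : (√a + √b) ^ 2 ≤ 6 * a := by nlinarith [sq_nonneg (√a - √b)]
  rw [div_le_iff₀ ha, e]
  nlinarith [mul_le_mul_of_nonneg_left h6 (sq_nonneg (√a - √b))]

/-- The contribution of one row to the progress of one iteration. -/
theorem row_progress {y₁ y₂ u v e e₀ Q Q₀ k : ℝ} (h1 : 0 < y₁) (h2 : 0 < y₂) (h12 : y₁ ≤ 2 * y₂)
    (h21 : y₂ ≤ 2 * y₁) (hQ : e ^ 2 ≤ Q) (hQ₀ : e₀ ^ 2 ≤ Q₀) (hk : u ^ 2 / y₂ ≤ 6 * k) :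
    y₂ * Q / 8 + 12 * (u ^ 2 / y₂) + 2 * u * e + 3 * (v * e) + u * e₀
      ≤ 120 * k + y₂ * Q + y₁ * Q₀ / 8 + 12 * (v ^ 2 / y₁) := by
  have hv : v ^ 2 / (2 * y₂) ≤ v ^ 2 / y₁ := by gcongr
  obtain ⟨U, rfl⟩ : ∃ U, u = U * y₂ := ⟨u / y₂, by field_simp⟩
  obtain ⟨V, rfl⟩ : ∃ V, v = V * y₂ := ⟨v / y₂, by field_simp⟩
  have e1 : (U * y₂) ^ 2 / y₂ = U ^ 2 * y₂ := by field_simp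
  have e2 : (V * y₂) ^ 2 / (2 * y₂) = V ^ 2 * y₂ / 2 := by field_simp
  rw [e1] at hk ⊢
  rw [e2] at hv
  have q1 := mul_le_mul_of_nonneg_left hQ h2.le
  have q2 := mul_le_mul_of_nonneg_left hQ₀ h1.le
  have q3 : y₂ * e₀ ^ 2 ≤ 2 * y₁ * e₀ ^ 2 := by gcongr
  -- After division by `y₂` the claim follows from `8 U² + 7 e² / 8 + e₀² / 16 + 6 V² ≥ 2 U e + 3 V
  -- e + U e₀`. The squares give `2 U e ≤ 4 U² + e² / 4`, `U e₀ ≤ 4 U² + e₀² / 16` and `3 V e ≤ 6 V²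
  -- + 3 e² / 8`. The `8 U²` is what `120 k ≥ 20 U² y₂` leaves after paying `12 U² y₂`.
  have s1 := mul_nonneg h2.le (sq_nonneg (4 * U - e))
  have s2 := mul_nonneg h2.le (sq_nonneg (8 * U - e₀))
  have s3 := mul_nonneg h2.le (sq_nonneg (4 * V - e))
  have s4 := mul_nonneg h2.le (sq_nonneg V)
  have s5 := mul_nonneg h2.le (sq_nonneg e)
  nlinarith

/-! ### The regularizer and the progress of one round -/

/-- The regularizer. -/
noncomputable def reg (M : Matrix I J ℝ) (x : J → ℝ) (y : I → ℝ) : ℝ :=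
  y ⬝ᵥ absMat M *ᵥ (x * x) + 120 * ∑ i, y i * Real.log (y i)

/-- An alternating minimization step for the regularized linear function with coefficients
`π ᵥ* M` and `-θ`: the resulting value is a lower bound up to the change of the weights. -/
theorem alternating_lower_bound [Nonempty I] (M : Matrix I J ℝ) {π θ y₀ y : I → ℝ} {x₁ x : J → ℝ}
    (hx : ∀ j, 0 ≤ ((π ᵥ* M) j + 2 * (y₀ ᵥ* absMat M) j * x₁ j) * (x j - x₁ j))
    (hy : ∑ i, y i = 1) :
    let y₁ := softmax fun i => (θ i - (absMat M *ᵥ (x₁ * x₁)) i) / 120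
    π ⬝ᵥ M *ᵥ x₁ - y₁ ⬝ᵥ θ + reg M x₁ y₁
      + 120 * ∑ i, (y i * Real.log (y i) - y i * Real.log (y₁ i))
      + y ⬝ᵥ absMat M *ᵥ ((x - x₁) * (x - x₁))
      + 2 * ((y - y₀) ⬝ᵥ absMat M *ᵥ (x₁ * (x - x₁)))
      ≤ π ⬝ᵥ M *ᵥ x - y ⬝ᵥ θ + reg M x y := by
  intro y₁
  have hy₁ : ∑ i, y₁ i = 1 := sum_softmax _
  set f : I → ℝ := fun i => (θ i - (absMat M *ᵥ (x₁ * x₁)) i) / 120 with hf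
  -- `log y₁` is the vector of logits minus a constant, so this pairing is affine in `z`. The
  -- log-partition term is the same for `z = y` and `z = y₁` and cancels.
  have key : ∀ z : I → ℝ, ∑ i, z i = 1 →
      120 * ∑ i, z i * Real.log (y₁ i)
        = z ⬝ᵥ θ - z ⬝ᵥ absMat M *ᵥ (x₁ * x₁) - 120 * Real.log (∑ k, Real.exp (f k)) := by
    intro z hz
    have : ∀ i, z i * Real.log (y₁ i) = (z i * θ i - z i * (absMat M *ᵥ (x₁ * x₁)) i) / 120
        - z i * Real.log (∑ k, Real.exp (f k)) := by
      intro i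
      rw [show Real.log (y₁ i) = _ from log_softmax f i, hf]; ring
    simp only [this, Finset.sum_sub_distrib, ← Finset.sum_div, ← Finset.sum_mul, hz, dotProduct]
    ring
  have k1 := key y hy
  have k2 := key y₁ hy₁
  -- The coordinatewise optimality conditions, summed. They carry the frozen weights `y₀`, whereas
  -- expanding `x * x` around `x₁` yields `y`; this is the source of the defect `y - y₀`.
  have hsum : 0 ≤ π ⬝ᵥ M *ᵥ (x - x₁) + 2 * (y₀ ⬝ᵥ absMat M *ᵥ (x₁ * (x - x₁))) := by
    have := Finset.sum_nonneg fun j (_ : j ∈ Finset.univ) => hx j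
    rw [Matrix.dotProduct_mulVec, Matrix.dotProduct_mulVec, dotProduct, dotProduct,
      Finset.mul_sum, ← Finset.sum_add_distrib]
    refine this.trans (le_of_eq (Finset.sum_congr rfl fun j _ => ?_))
    simp only [Pi.sub_apply, Pi.mul_apply]; ring
  have e : x * x = x₁ * x₁ + (x - x₁) * (x - x₁) + (x₁ * (x - x₁) + x₁ * (x - x₁)) := by ring
  have e2 : M *ᵥ x = M *ᵥ x₁ + M *ᵥ (x - x₁) := by rw [← Matrix.mulVec_add]; congr 1; ring
  simp only [reg, Finset.sum_sub_distrib]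
  rw [e, e2]
  simp only [Matrix.mulVec_add, dotProduct_add, sub_dotProduct]
  linarith

/-- The quantity that pays for the variation of the weights between iterations. -/
noncomputable def variation (M : Matrix I J ℝ) (x : J → ℝ) (y : I → ℝ) (x' : J → ℝ) (y' : I → ℝ) :
    ℝ :=
  y' ⬝ᵥ absMat M *ᵥ ((x' - x) * (x' - x)) / 8 + 12 * ∑ i, (y' i - y i) ^ 2 / y' i

theorem variation_nonneg (M : Matrix I J ℝ) (x : J → ℝ) (y : I → ℝ) (x' : J → ℝ) {y' : I → ℝ}
    (hy : ∀ i, 0 < y' i) : 0 ≤ variation M x y x' y' := by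
  unfold variation
  refine add_nonneg (div_nonneg (Finset.sum_nonneg fun i _ => mul_nonneg (hy i).le
    (absMat_mulVec_nonneg M (fun j => mul_self_nonneg _) i)) (by norm_num)) ?_
  exact mul_nonneg (by norm_num) (Finset.sum_nonneg fun i _ => div_nonneg (sq_nonneg _) (hy i).le)

/-- The last two lines are the errors of frozen weights and of optimistic guesses. Row by row each
is a product of a change of `y` and a change of `x`, so `row_progress` bounds it by the curvature
gained in this round plus the difference of two successive variations. -/
theorem variation_progress {M : Matrix I J ℝ} (hM : ∀ i, ∑ j, |M i j| ≤ 1)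
    {x₀ x₁ x₂ : J → ℝ} {y₀ y₁ y₂ : I → ℝ} (hx₁ : ∀ j, |x₁ j| ≤ 1)
    (hy₁ : ∀ i, 0 < y₁ i) (hy₂ : ∀ i, 0 < y₂ i)
    (h12 : ∀ i, y₁ i ≤ 2 * y₂ i) (h21 : ∀ i, y₂ i ≤ 2 * y₁ i) (hs : ∑ i, y₁ i = ∑ i, y₂ i) :
    variation M x₁ y₁ x₂ y₂ ≤ variation M x₀ y₀ x₁ y₁
      + 120 * ∑ i, (y₂ i * Real.log (y₂ i) - y₂ i * Real.log (y₁ i))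
      + y₂ ⬝ᵥ absMat M *ᵥ ((x₂ - x₁) * (x₂ - x₁))
      + 2 * ((y₂ - y₀) ⬝ᵥ absMat M *ᵥ (x₁ * (x₂ - x₁)))
      + ((y₁ - y₀) ⬝ᵥ M *ᵥ (x₂ - x₁) - (y₂ - y₁) ⬝ᵥ M *ᵥ (x₁ - x₀)) := by
  -- The masses agree, so the linear terms may be inserted; they make each row's contribution
  -- nonnegative and comparable with `(y₂ - y₁)² / y₂`.
  have hkl : ∑ i, (y₂ i * Real.log (y₂ i) - y₂ i * Real.log (y₁ i))
      = ∑ i, (y₂ i * Real.log (y₂ i) - y₂ i * Real.log (y₁ i) - y₂ i + y₁ i) := by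
    simp only [Finset.sum_sub_distrib, Finset.sum_add_distrib, hs]; ring
  rw [hkl]
  simp only [variation, dotProduct, Finset.mul_sum, Finset.sum_div, ← Finset.sum_add_distrib,
    ← Finset.sum_sub_distrib]
  refine Finset.sum_le_sum fun i _ => ?_
  have hrow := row_progress (hy₁ i) (hy₂ i) (h12 i) (h21 i)
    (sq_absMat_mulVec_le hM (x₂ - x₁) i) (sq_absMat_mulVec_le hM (x₁ - x₀) i)
    (u := |y₂ i - y₁ i|) (v := |y₁ i - y₀ i|)
    (by rw [sq_abs]; exact sq_sub_div_le_entropy (hy₂ i) (hy₁ i) (h12 i))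
  rw [sq_abs, sq_abs] at hrow
  have he := absMat_mulVec_nonneg M (x := |x₂ - x₁|) (fun j => abs_nonneg _) i
  have c1 : |(absMat M *ᵥ (x₁ * (x₂ - x₁))) i| ≤ (absMat M *ᵥ |x₂ - x₁|) i := by
    refine (Finset.abs_sum_le_sum_abs _ _).trans (Finset.sum_le_sum fun j _ => ?_)
    rw [abs_mul, Pi.mul_apply, abs_mul, Pi.abs_apply]
    simp only [absMat, abs_abs]
    exact mul_le_mul_of_nonneg_left (mul_le_of_le_one_left (abs_nonneg _) (hx₁ j)) (abs_nonneg _)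
  have c2 := abs_mulVec_le_absMat M (x₂ - x₁) i
  have c3 := abs_mulVec_le_absMat M (x₁ - x₀) i
  have tri : |y₂ i - y₀ i| ≤ |y₂ i - y₁ i| + |y₁ i - y₀ i| := abs_sub_le _ _ _
  have aux : ∀ {a b A B : ℝ}, |a| ≤ A → |b| ≤ B → -(A * B) ≤ a * b ∧ a * b ≤ A * B := by
    intro a b A B ha hb
    rw [← abs_le, abs_mul]
    exact mul_le_mul ha hb (abs_nonneg _) ((abs_nonneg _).trans ha)
  have d1 := (aux tri c1).1
  have d2 := (aux (le_refl |y₁ i - y₀ i|) c2).1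
  have d3 := (aux (le_refl |y₂ i - y₁ i|) c3).2
  simp only [Pi.sub_apply] at *
  linarith

end Game

/-! ### The iteration and its regret -/

section Game

variable {I J : Type*} [Fintype J]

theorem absMat_mulVec_sq_mem {M : Matrix I J ℝ} (hM : ∀ i, ∑ j, |M i j| ≤ 1) {x : J → ℝ}
    (hx : ∀ j, |x j| ≤ 1) (i : I) :
    0 ≤ (absMat M *ᵥ (x * x)) i ∧ (absMat M *ᵥ (x * x)) i ≤ 1 := by
  refine ⟨absMat_mulVec_nonneg M (fun j => mul_self_nonneg _) i, ?_⟩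
  refine (le_abs_self _).trans (abs_mulVec_le (absMat_row_le hM) zero_le_one (fun j => ?_) i)
  rw [Pi.mul_apply, abs_mul]
  exact mul_le_one₀ (hx j) (abs_nonneg _) (hx j)

variable [Fintype I]

theorem abs_dotProduct_sub_le {y y' v : I → ℝ} {c : ℝ} (hy : ∀ i, 0 ≤ y i) (hy' : ∀ i, 0 ≤ y' i)
    (hs : ∑ i, y i = 1) (hs' : ∑ i, y' i = 1) (hv : ∀ i, |v i| ≤ c) :
    |(y - y') ⬝ᵥ v| ≤ 2 * c := by
  refine (Finset.abs_sum_le_sum_abs _ _).trans ?_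
  calc ∑ i, |(y - y') i * v i| ≤ ∑ i, (y i + y' i) * c := by
        refine Finset.sum_le_sum fun i _ => ?_
        rw [abs_mul]
        refine mul_le_mul ?_ (hv i) (abs_nonneg _) (add_nonneg (hy i) (hy' i))
        exact abs_le.2 ⟨by simp only [Pi.sub_apply]; linarith [hy i],
          by simp only [Pi.sub_apply]; linarith [hy' i]⟩
    _ = 2 * c := by rw [← Finset.sum_mul, Finset.sum_add_distrib, hs, hs']; ring

/-- The quadratic part is nonnegative; the entropy is compared with the uniform distribution. -/
theorem reg_ge [Nonempty I] (M : Matrix I J ℝ) {x : J → ℝ} {y : I → ℝ} (hy : ∀ i, 0 < y i)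
    (hs : ∑ i, y i = 1) :
    -(120 * Real.log (Fintype.card I)) ≤ reg M x y := by
  have h0 : 0 ≤ y ⬝ᵥ absMat M *ᵥ (x * x) := Finset.sum_nonneg fun i _ =>
    mul_nonneg (hy i).le (absMat_mulVec_nonneg M (fun j => mul_self_nonneg _) i)
  have hc : (0 : ℝ) < Fintype.card I := by exact_mod_cast Fintype.card_pos
  have h1 := Finset.sum_le_sum fun i (_ : i ∈ Finset.univ) =>
    entropy_nonneg (b := (Fintype.card I : ℝ)⁻¹) (hy i).le (by positivity)
  simp only [Finset.sum_sub_distrib, ← Finset.sum_mul, hs, Finset.sum_const, Finset.card_univ,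
    nsmul_eq_mul, mul_inv_cancel₀ hc.ne', Real.log_inv] at h1
  unfold reg
  linarith

/-- The current pair of strategies and the sums of the previous ones. -/
structure Play (I J : Type*) where
  x : J → ℝ
  y : I → ℝ
  X : J → ℝ
  Y : I → ℝ

/-- The box player's next strategy. -/
noncomputable def Play.nextX (M : Matrix I J ℝ) (s : Play I J) (j : J) : ℝ :=
  clip (-((s.Y + s.y) ᵥ* M) j / (2 * (s.y ᵥ* absMat M) j))

/-- The logits of the simplex player's next strategy. -/
noncomputable def Play.logit (M : Matrix I J ℝ) (d : I → ℝ) (t : ℕ) (s : Play I J) (i : I) : ℝ :=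
  ((M *ᵥ (s.X + s.x)) i + (t + 1) * d i - (absMat M *ᵥ (s.nextX M * s.nextX M)) i) / 120

/-- One iteration: optimistic dual averaging with alternating minimization. -/
noncomputable def Play.next (M : Matrix I J ℝ) (d : I → ℝ) (t : ℕ) (s : Play I J) : Play I J where
  x := s.nextX M
  y := softmax (s.logit M d t)
  X := s.X + s.nextX M
  Y := s.Y + softmax (s.logit M d t)

/-- The state of the method after `t` iterations. -/
noncomputable def play (M : Matrix I J ℝ) (d : I → ℝ) : ℕ → Play I J
  -- The starting pair is only the first guess: the sums start empty and never include it.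
  | 0 => ⟨0, softmax 0, 0, 0⟩
  | t + 1 => (play M d t).next M d t

variable (M : Matrix I J ℝ) (d : I → ℝ)

theorem abs_play_x_le (t : ℕ) (j : J) : |(play M d t).x j| ≤ 1 := by
  cases t with
  | zero => simp [play]
  | succ t => exact abs_clip_le _

theorem abs_play_X_le (t : ℕ) (j : J) : |(play M d t).X j| ≤ t := by
  induction t with
  | zero => simp [play]
  | succ t ih =>
    refine (abs_add_le _ _).trans ?_
    push_cast
    exact add_le_add ih (abs_clip_le _)

/-- The payoff changes by `M (2 x_{t+1} - x_t)`, at most `3`, the offset adds at most `2`, and the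
quadratic term varies by at most `1`. The total `6` over `120` is `1 / 20`. -/
theorem abs_logit_sub_le {M : Matrix I J ℝ} {d : I → ℝ}
    (hM : ∀ i, ∑ j, |M i j| ≤ 1) (hd : ∀ i, |d i| ≤ 2)
    (t : ℕ) (i : I) :
    |(play M d (t + 1)).logit M d (t + 1) i - (play M d t).logit M d t i| ≤ 1 / 20 := by
  have h1 := absMat_mulVec_sq_mem hM (abs_play_x_le M d (t + 1)) i
  have h2 := absMat_mulVec_sq_mem hM (abs_play_x_le M d (t + 2)) i
  have h3 := abs_le.1 <| abs_mulVec_le hM zero_le_one (abs_play_x_le M d (t + 1)) i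
  have h4 := abs_le.1 <| abs_mulVec_le hM zero_le_one (abs_play_x_le M d t) i
  have h5 := abs_le.1 (hd i)
  simp only [play, Play.next, Play.logit, Matrix.mulVec_add, Pi.add_apply] at *
  push_cast
  rw [abs_le]
  constructor <;> linarith

theorem abs_logit_zero_le {M : Matrix I J ℝ} {d : I → ℝ}
    (hM : ∀ i, ∑ j, |M i j| ≤ 1) (hd : ∀ i, |d i| ≤ 2)
    (i : I) :
    |(play M d 0).logit M d 0 i - 0| ≤ 1 / 20 := by
  have h1 := absMat_mulVec_sq_mem hM (abs_play_x_le M d 1) i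
  have h5 := abs_le.1 (hd i)
  simp only [play, Play.next, Play.logit, add_zero, Matrix.mulVec_zero, Pi.zero_apply] at *
  push_cast
  rw [abs_le]
  constructor <;> linarith

variable [Nonempty I]

theorem play_y_pos (t : ℕ) (i : I) : 0 < (play M d t).y i := by
  cases t <;> exact softmax_pos _ _

theorem sum_play_y (t : ℕ) : ∑ i, (play M d t).y i = 1 := by
  cases t <;> exact sum_softmax _

theorem sum_play_Y (t : ℕ) : ∑ i, (play M d t).Y i = t := by
  induction t with
  | zero => simp [play]
  | succ t ih =>
    have := sum_play_y M d (t + 1)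
    simp only [play, Play.next, Pi.add_apply, Finset.sum_add_distrib] at this ih ⊢
    rw [ih, this]; push_cast; rfl

theorem play_Y_nonneg (t : ℕ) (i : I) : 0 ≤ (play M d t).Y i := by
  induction t with
  | zero => simp [play]
  | succ t ih => exact add_nonneg ih (softmax_pos _ _).le

/-- The frozen problem is separable, with one clipped quadratic per coordinate. If a quadratic
coefficient vanishes, positivity of `y` makes that column of `M` zero, so the linear coefficient
vanishes too. -/
theorem play_x_optimal (t : ℕ) {x : J → ℝ} (hx : ∀ j, |x j| ≤ 1) (j : J) :
    0 ≤ ((((play M d t).Y + (play M d t).y) ᵥ* M) j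
      + 2 * ((play M d t).y ᵥ* absMat M) j * (play M d (t + 1)).x j)
        * (x j - (play M d (t + 1)).x j) := by
  refine clip_optimal ?_ ?_ (hx j)
  · exact Finset.sum_nonneg fun i _ => mul_nonneg (play_y_pos M d t i).le (abs_nonneg _)
  · intro h
    have h' := (Finset.sum_eq_zero_iff_of_nonneg fun i _ =>
      mul_nonneg (play_y_pos M d t i).le (abs_nonneg (M i j))).1 h
    refine Finset.sum_eq_zero fun i hi => ?_
    have := (mul_eq_zero.1 (h' i hi)).resolve_left (play_y_pos M d t i).ne'
    exact mul_eq_zero_of_right _ (abs_eq_zero.1 this)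

variable {M d}
theorem play_y_ratio (hM : ∀ i, ∑ j, |M i j| ≤ 1) (hd : ∀ i, |d i| ≤ 2)
    (t : ℕ) (i : I) :
    (play M d t).y i ≤ 2 * (play M d (t + 1)).y i ∧
      (play M d (t + 1)).y i ≤ 2 * (play M d t).y i := by
  -- The strategy at time `t + 1` has the logits computed at time `t`; the initial uniform strategy
  -- has logits `0`.
  have h : ∀ i, |(play M d t).logit M d t i - (match t with
      | 0 => 0
      | t + 1 => (play M d t).logit M d t) i| ≤ 1 / 20 := by
    cases t with
    | zero => exact abs_logit_zero_le hM hd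
    | succ t => exact abs_logit_sub_le hM hd t
  have h' := fun i => (abs_sub_comm _ _).trans_le (h i)
  cases t with
  | zero => exact ⟨softmax_le_two_mul h' i, softmax_le_two_mul h i⟩
  | succ t => exact ⟨softmax_le_two_mul h' i, softmax_le_two_mul h i⟩

/-- The potential grows with the payoffs. -/
theorem potential_ge (hM : ∀ i, ∑ j, |M i j| ≤ 1) (hd : ∀ i, |d i| ≤ 2)
    (t : ℕ) :
    -(120 * Real.log (Fintype.card I)) - (play M d t).Y ⬝ᵥ d
      + variation M (play M d t).x (play M d t).y (play M d (t + 1)).x (play M d (t + 1)).y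
      - variation M (play M d 0).x (play M d 0).y (play M d 1).x (play M d 1).y
    ≤ (play M d t).Y ⬝ᵥ M *ᵥ (play M d (t + 1)).x
      - (play M d (t + 1)).y ⬝ᵥ (M *ᵥ (play M d t).X + (t : ℝ) • d)
      + reg M (play M d (t + 1)).x (play M d (t + 1)).y := by
  induction t with
  | zero =>
    have := reg_ge M (x := (play M d 1).x) (play_y_pos M d 1) (sum_play_y M d 1)
    simp only [zero_add, play, zero_dotProduct, Matrix.mulVec_zero, Nat.cast_zero, zero_smul,
      dotProduct_zero] at *
    linarith
  | succ t ih =>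
    -- Optimality of round `t + 1`, tested at the strategies of round `t + 2`. It involves guessed
    -- payoffs; replacing them by the true ones leaves exactly the bilinear terms of
    -- `variation_progress`, since `y₁ ⬝ᵥ M *ᵥ x₁` enters with both signs and only `-(y₁ ⬝ᵥ d)`
    -- accumulates.
    have h1 := alternating_lower_bound M (θ := M *ᵥ ((play M d t).X + (play M d t).x)
      + ((t : ℝ) + 1) • d) (play_x_optimal M d t (abs_play_x_le M d (t + 2)))
      (sum_play_y M d (t + 2))
    have h2 := variation_progress hM (x₀ := (play M d t).x) (y₀ := (play M d t).y)
      (x₂ := (play M d (t + 2)).x)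
      (abs_play_x_le M d (t + 1)) (play_y_pos M d (t + 1)) (play_y_pos M d (t + 2))
      (fun i => (play_y_ratio hM hd (t + 1) i).1) (fun i => (play_y_ratio hM hd (t + 1) i).2)
      ((sum_play_y M d _).trans (sum_play_y M d _).symm)
    have hy : (softmax fun i => ((M *ᵥ ((play M d t).X + (play M d t).x)
        + ((t : ℝ) + 1) • d) i - (absMat M *ᵥ ((play M d (t + 1)).x * (play M d (t + 1)).x)) i)
          / 120) = (play M d (t + 1)).y := rfl
    have hX : (play M d (t + 1)).X = (play M d t).X + (play M d (t + 1)).x := rfl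
    have hY : (play M d (t + 1)).Y = (play M d t).Y + (play M d (t + 1)).y := rfl
    simp only [hy] at h1
    rw [hX, hY]
    generalize play M d (t + 2) = s₂ at *
    generalize play M d (t + 1) = s₁ at *
    generalize play M d t = s₀ at *
    push_cast
    simp only [Matrix.mulVec_add, Matrix.mulVec_sub, dotProduct_add, add_dotProduct,
      sub_dotProduct, dotProduct_sub, dotProduct_smul, smul_eq_mul] at *
    linarith

/-- The average of the box player's strategies is optimal up to `O(log |I| / T)`. -/
theorem play_gap (hM : ∀ i, ∑ j, |M i j| ≤ 1) (hd : ∀ i, |d i| ≤ 2)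
    {v : J → ℝ} (hv : ∀ j, |v j| ≤ 1) {c : ℝ} (hc : ∀ i, (M *ᵥ v) i + d i ≤ c)
    (T : ℕ) (i : I) :
    (M *ᵥ (play M d T).X) i + T * d i ≤ T * c + (30 + 120 * Real.log (Fintype.card I)) := by
  classical
  -- The simplex player's comparator is the pure strategy of row `i`; its entropy is `0`.
  set u : I → ℝ := Pi.single i 1 with hu
  have hu0 : ∀ k, 0 ≤ u k := fun k => by
    simp only [hu, Pi.single_apply]; split_ifs <;> norm_num
  have hu1 : ∑ k, u k = 1 := by simp [hu]
  have h1 := alternating_lower_bound M (θ := M *ᵥ ((play M d T).X + (play M d T).x)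
    + ((T : ℝ) + 1) • d) (play_x_optimal M d T hv) hu1
  have hy : (softmax fun i => ((M *ᵥ ((play M d T).X + (play M d T).x)
      + ((T : ℝ) + 1) • d) i - (absMat M *ᵥ ((play M d (T + 1)).x * (play M d (T + 1)).x)) i)
        / 120) = (play M d (T + 1)).y := rfl
  simp only [hy] at h1
  have h2 := potential_ge hM hd T
  have h3 := variation_nonneg M (play M d T).x (play M d T).y (play M d (T + 1)).x
    (play_y_pos M d (T + 1))
  -- The initial variation is at most `1 / 8 + 12`: since `y₀ ≤ 2 y₁`, each `(y₁ - y₀)² / y₁` is at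
  -- most `y₁`.
  have h4 : variation M (play M d 0).x (play M d 0).y (play M d 1).x (play M d 1).y ≤ 13 := by
    have e : (play M d 0).x = 0 := rfl
    have hE : (play M d 1).y ⬝ᵥ absMat M *ᵥ ((play M d 1).x * (play M d 1).x) ≤ 1 := by
      rw [← sum_play_y M d 1]
      refine Finset.sum_le_sum fun k _ => mul_le_of_le_one_right (play_y_pos M d 1 k).le ?_
      exact (absMat_mulVec_sq_mem hM (abs_play_x_le M d 1) k).2
    have hS : ∑ k, ((play M d 1).y k - (play M d 0).y k) ^ 2 / (play M d 1).y k ≤ 1 := by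
      rw [← sum_play_y M d 1]
      refine Finset.sum_le_sum fun k _ => ?_
      have p1 := play_y_pos M d 1 k
      have p0 := play_y_pos M d 0 k
      have p2 := (play_y_ratio hM hd 0 k).1
      rw [zero_add] at p2
      rw [div_le_iff₀ p1]
      nlinarith
    rw [variation, e, sub_zero]
    linarith
  have h5 : 0 ≤ ∑ k, (u k * Real.log (u k) - u k * Real.log ((play M d (T + 1)).y k)) := by
    have := Finset.sum_le_sum fun k (_ : k ∈ Finset.univ) =>
      entropy_nonneg (hu0 k) (play_y_pos M d (T + 1) k)
    rwa [Finset.sum_sub_distrib, hu1, sum_play_y, sub_self] at this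
  have h6 : 0 ≤ u ⬝ᵥ absMat M *ᵥ ((v - (play M d (T + 1)).x) * (v - (play M d (T + 1)).x)) :=
    Finset.sum_nonneg fun k _ =>
      mul_nonneg (hu0 k) (absMat_mulVec_nonneg M (fun j => mul_self_nonneg _) k)
  have hdiff : ∀ j, |(v - (play M d (T + 1)).x) j| ≤ 2 := fun j =>
    (abs_sub _ _).trans (by linarith [hv j, abs_play_x_le M d (T + 1) j])
  have h7 := abs_le.1 <| abs_dotProduct_sub_le hu0 (fun k => (play_y_pos M d T k).le) hu1
    (sum_play_y M d T) (abs_mulVec_le (absMat_row_le hM) zero_le_two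
      (x := (play M d (T + 1)).x * (v - (play M d (T + 1)).x)) fun j => by
        rw [Pi.mul_apply, abs_mul]
        exact (mul_le_of_le_one_left (abs_nonneg _) (abs_play_x_le M d _ j)).trans (hdiff j))
  have h8 : |(play M d T).y ⬝ᵥ M *ᵥ (v - (play M d (T + 1)).x)| ≤ 2 := by
    refine (Finset.abs_sum_le_sum_abs _ _).trans ?_
    rw [← mul_one (2 : ℝ), ← sum_play_y M d T, Finset.mul_sum]
    refine Finset.sum_le_sum fun k _ => ?_
    rw [abs_mul, abs_of_pos (play_y_pos M d T k), mul_comm]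
    exact mul_le_mul_of_nonneg_right (abs_mulVec_le hM zero_le_two hdiff k)
      (play_y_pos M d T k).le
  have h9 := abs_le.1 <| abs_dotProduct_sub_le (fun k => (play_y_pos M d (T + 1) k).le) hu0
    (sum_play_y M d (T + 1)) hu1 (v := M *ᵥ (play M d T).x + d) (c := 3) fun k =>
      (abs_add_le _ _).trans (by
        linarith [hd k, abs_mulVec_le hM zero_le_one (abs_play_x_le M d T) k])
  have h10 : reg M v u ≤ 1 := by
    have : ∑ k, u k * Real.log (u k) = 0 := Finset.sum_eq_zero fun k _ => by
      simp only [hu, Pi.single_apply]; split_ifs <;> simp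
    rw [reg, this, hu, single_dotProduct]
    linarith [(absMat_mulVec_sq_mem hM hv i).2]
  have h11 : (play M d T).Y ⬝ᵥ M *ᵥ v + (play M d T).Y ⬝ᵥ d ≤ T * c := by
    rw [← dotProduct_add, ← sum_play_Y M d T, Finset.sum_mul]
    exact Finset.sum_le_sum fun k _ => mul_le_mul_of_nonneg_left (hc k) (play_Y_nonneg M d T k)
  have h12 : u ⬝ᵥ M *ᵥ (play M d T).X = (M *ᵥ (play M d T).X) i := by
    rw [hu, single_dotProduct, one_mul]
  have h13 : u ⬝ᵥ d = d i := by rw [hu, single_dotProduct, one_mul]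
  rw [← h12, ← h13]
  have h8' := abs_le.1 h8
  generalize play M d (T + 1) = s₁ at *
  generalize play M d T = s₀ at *
  simp only [Matrix.mulVec_add, Matrix.mulVec_sub, dotProduct_add, add_dotProduct,
    sub_dotProduct, dotProduct_sub, dotProduct_smul, smul_eq_mul] at *
  -- The constant `30` is `13` for the initial variation, `8` for frozen weights (twice `h7`), `2`
  -- and `6` for the last guesses (`h8`, `h9`), and `1` for the regularizer at the comparator.
  linarith

end Game
/-! ### Regression as a game -/

section Regression

variable {n m : ℕ}

/-- The rows of `B` and their negatives. -/
def signedRows (B : Matrix (Fin n) (Fin m) ℝ) : Matrix (Fin n ⊕ Fin n) (Fin m) ℝ :=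
  Matrix.fromRows B (-B)

/-- Offsets of the rows, relative to the largest one and truncated where they do not matter. -/
noncomputable def offsets (b : Fin n → ℝ) (β : ℝ) : Fin n ⊕ Fin n → ℝ :=
  Sum.elim (fun i => max (-b i - β) (-2)) (fun i => max (b i - β) (-2))

theorem signedRows_le {B : Matrix (Fin n) (Fin m) ℝ} (hB : ∀ i, ∑ j, |B i j| ≤ 1)
    (i : Fin n ⊕ Fin n) : ∑ j, |signedRows B i j| ≤ 1 := by
  cases i <;> simpa [signedRows] using hB _

theorem abs_offsets_le {b : Fin n → ℝ} {β : ℝ} (hb : ∀ i, |b i| ≤ β) (i : Fin n ⊕ Fin n) :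
    |offsets b β i| ≤ 2 := by
  rw [abs_le]
  cases i with
  | inl i =>
    refine ⟨le_max_right _ _, max_le ?_ (by norm_num)⟩
    linarith [(abs_le.1 (hb i)).1]
  | inr i =>
    refine ⟨le_max_right _ _, max_le ?_ (by norm_num)⟩
    linarith [(abs_le.1 (hb i)).2]

/-- The averaged strategy approximately minimizes the norm of the residual over the box. -/
theorem regression_gap {B : Matrix (Fin n) (Fin m) ℝ} (hB : ∀ i, ∑ j, |B i j| ≤ 1)
    {b : Fin n → ℝ} {β : ℝ} (hb : ∀ i, |b i| ≤ β) (hβ : ∃ i, |b i| = β) {v : Fin m → ℝ}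
    (hv : ∀ j, |v j| ≤ 1) {T : ℕ} (hT : 0 < T) :
    ‖B *ᵥ (fun j => (play (signedRows B) (offsets b β) T).X j / T) - b‖
      ≤ ‖B *ᵥ v - b‖ + (30 + 120 * Real.log (2 * n)) / T := by
  obtain ⟨i₀, hi₀⟩ := hβ
  have : Nonempty (Fin n ⊕ Fin n) := ⟨Sum.inl i₀⟩
  have hn : 0 < n := i₀.pos
  have hT' : (0 : ℝ) < T := by exact_mod_cast hT
  have hnorm : ∀ i, |(B *ᵥ v) i - b i| ≤ ‖B *ᵥ v - b‖ := fun i => norm_le_pi_norm (B *ᵥ v - b) i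
  have hbig : β - 1 ≤ ‖B *ᵥ v - b‖ := by
    have h1 := abs_mulVec_le hB zero_le_one hv i₀
    have h2 := abs_sub_abs_le_abs_sub (b i₀) ((B *ᵥ v) i₀)
    rw [abs_sub_comm] at h2
    linarith [hnorm i₀]
  -- Truncation at `-2` is harmless: a truncated row contributes at most `1 - 2`, and `hbig` says
  -- that the right-hand side is at least `-1`. Bounded offsets are what keeps the softmax stable.
  have hc : ∀ i, (signedRows B *ᵥ v) i + offsets b β i ≤ ‖B *ᵥ v - b‖ - β := by
    intro i
    cases i with
    | inl i =>
      have h1 := abs_le.1 (abs_mulVec_le hB zero_le_one hv i)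
      have h2 := abs_le.1 (hnorm i)
      simp only [signedRows, offsets, Matrix.fromRows_mulVec, Sum.elim_inl]
      rw [← max_add_add_left]
      exact max_le (by linarith) (by linarith)
    | inr i =>
      have h1 := abs_le.1 (abs_mulVec_le hB zero_le_one hv i)
      have h2 := abs_le.1 (hnorm i)
      simp only [signedRows, offsets, Matrix.fromRows_mulVec, Sum.elim_inr, Matrix.neg_mulVec,
        Pi.neg_apply]
      rw [← max_add_add_left]
      exact max_le (by linarith) (by linarith)
  have hgap := play_gap (signedRows_le hB) (abs_offsets_le hb) hv hc T
  have hcard : (Fintype.card (Fin n ⊕ Fin n) : ℝ) = 2 * n := by simp; ring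
  rw [hcard] at hgap
  generalize play (signedRows B) (offsets b β) T = s at *
  have hlog : 0 ≤ Real.log (2 * n) := Real.log_nonneg (by
    have : (1 : ℝ) ≤ n := by exact_mod_cast hn
    linarith)
  refine (pi_norm_le_iff_of_nonneg (by positivity)).2 fun i => ?_
  have e : (B *ᵥ (fun j => s.X j / T)) i = (B *ᵥ s.X) i / T := by
    simp only [Matrix.mulVec, dotProduct, Finset.sum_div, mul_div_assoc]
  have h1 := hgap (Sum.inl i)
  have h2 := hgap (Sum.inr i)
  simp only [signedRows, offsets, Matrix.fromRows_mulVec, Sum.elim_inl, Sum.elim_inr,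
    Matrix.neg_mulVec, Pi.neg_apply] at h1 h2
  -- Truncation only raises offsets, so the bounds for the truncated game imply those for the true
  -- residual, and `β` cancels.
  have h3 := mul_le_mul_of_nonneg_left (le_max_left (-b i - β) (-2)) hT'.le
  have h4 := mul_le_mul_of_nonneg_left (le_max_left (b i - β) (-2)) hT'.le
  rw [Pi.sub_apply, e, Real.norm_eq_abs, show (B *ᵥ s.X) i / T - b i
    = ((B *ᵥ s.X) i - T * b i) / T by field_simp, abs_div, abs_of_pos hT', div_le_iff₀ hT',
    add_mul, div_mul_cancel₀ _ hT'.ne', abs_le]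
  constructor <;> nlinarith

end Regression
/-! ### Reasoning about programs -/

namespace Prog

/-- The natural-number variables that a program may write. -/
def nvars : Prog → List ℕ
  | nset a _ => [a]
  | seq p q => p.nvars ++ q.nvars
  | ite _ p q => p.nvars ++ q.nvars
  | loop _ p => p.nvars
  | _ => []

/-- The real variables that a program may write. -/
def rvars : Prog → List ℕ
  | rset a _ => [a]
  | toss a => [a]
  | seq p q => p.rvars ++ q.rvars
  | ite _ p q => p.rvars ++ q.rvars
  | loop _ p => p.rvars
  | _ => []

/-- The natural-number arrays that a program may write. -/
def narrs : Prog → List ℕ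
  | nput a _ _ => [a]
  | seq p q => p.narrs ++ q.narrs
  | ite _ p q => p.narrs ++ q.narrs
  | loop _ p => p.narrs
  | _ => []

/-- The real arrays that a program may write. -/
def rarrs : Prog → List ℕ
  | rput a _ _ => [a]
  | seq p q => p.rarrs ++ q.rarrs
  | ite _ p q => p.rarrs ++ q.rarrs
  | loop _ p => p.rarrs
  | _ => []

/-- The two states agree on everything that `p` does not write. -/
structure Frame (p : Prog) (s s' : State) : Prop where
  nvar : ∀ a ∉ p.nvars, s'.nvar a = s.nvar a
  rvar : ∀ a ∉ p.rvars, s'.rvar a = s.rvar a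
  narr : ∀ a ∉ p.narrs, s'.narr a = s.narr a
  rarr : ∀ a ∉ p.rarrs, s'.rarr a = s.rarr a

theorem Frame.refl (p : Prog) (s : State) : Frame p s s :=
  ⟨fun _ _ => rfl, fun _ _ => rfl, fun _ _ => rfl, fun _ _ => rfl⟩

theorem Frame.trans {p : Prog} {s s' s'' : State} (h : Frame p s s') (h' : Frame p s' s'') :
    Frame p s s'' :=
  ⟨fun a ha => (h'.nvar a ha).trans (h.nvar a ha), fun a ha => (h'.rvar a ha).trans (h.rvar a ha),
    fun a ha => (h'.narr a ha).trans (h.narr a ha), fun a ha => (h'.rarr a ha).trans (h.rarr a ha)⟩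

theorem Frame.mono {p q : Prog} {s s' : State} (h : Frame p s s') (h1 : p.nvars ⊆ q.nvars)
    (h2 : p.rvars ⊆ q.rvars) (h3 : p.narrs ⊆ q.narrs) (h4 : p.rarrs ⊆ q.rarrs) : Frame q s s' :=
  ⟨fun a ha => h.nvar a fun h => ha (h1 h), fun a ha => h.rvar a fun h => ha (h2 h),
    fun a ha => h.narr a fun h => ha (h3 h), fun a ha => h.rarr a fun h => ha (h4 h)⟩

theorem Frame.seq_left {p q : Prog} {s s' : State} (h : Frame p s s') : Frame (.seq p q) s s' :=
  h.mono (List.subset_append_left _ _) (List.subset_append_left _ _)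
    (List.subset_append_left _ _) (List.subset_append_left _ _)

theorem Frame.seq_right {p q : Prog} {s s' : State} (h : Frame q s s') : Frame (.seq p q) s s' :=
  h.mono (List.subset_append_right _ _) (List.subset_append_right _ _)
    (List.subset_append_right _ _) (List.subset_append_right _ _)

end Prog

/-- The lists of written names are syntactic, so for a concrete program the survival of a variable
or array is settled by `decide`. -/
theorem Exec.frame {p : Prog} {s s' : State} {T : ℕ} (h : Exec p s s' T) : p.Frame s s' := by
  induction h with
  | skip s => exact .refl _ _
  | nset s a e =>
    refine ⟨fun c hc => ?_, fun _ _ => rfl, fun _ _ => rfl, fun _ _ => rfl⟩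
    exact Function.update_of_ne (by simpa [Prog.nvars] using hc) _ _
  | rset s a e =>
    refine ⟨fun _ _ => rfl, fun c hc => ?_, fun _ _ => rfl, fun _ _ => rfl⟩
    exact Function.update_of_ne (by simpa [Prog.rvars] using hc) _ _
  | nput s a i e =>
    refine ⟨fun _ _ => rfl, fun _ _ => rfl, fun c hc => ?_, fun _ _ => rfl⟩
    exact Function.update_of_ne (by simpa [Prog.narrs] using hc) _ _
  | rput s a i e =>
    refine ⟨fun _ _ => rfl, fun _ _ => rfl, fun _ _ => rfl, fun c hc => ?_⟩
    exact Function.update_of_ne (by simpa [Prog.rarrs] using hc) _ _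
  | toss s a =>
    refine ⟨fun _ _ => rfl, fun c hc => ?_, fun _ _ => rfl, fun _ _ => rfl⟩
    exact Function.update_of_ne (by simpa [Prog.rvars] using hc) _ _
  | seq _ _ ih1 ih2 => exact ih1.seq_left.trans ih2.seq_right
  | ite_true _ _ ih =>
    exact ih.mono (List.subset_append_left _ _) (List.subset_append_left _ _)
      (List.subset_append_left _ _) (List.subset_append_left _ _)
  | ite_false _ _ ih =>
    exact ih.mono (List.subset_append_right _ _) (List.subset_append_right _ _)
      (List.subset_append_right _ _) (List.subset_append_right _ _)
  | loop_true _ _ _ ih1 ih2 =>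
    exact Prog.Frame.trans (p := .loop _ _)
      (ih1.mono (fun _ h => h) (fun _ h => h) (fun _ h => h) (fun _ h => h)) ih2
  | loop_false _ => exact .refl _ _

/-! ### Program triples with time bounds -/

/-- Started in `s`, the program `p` halts within time `T` in a state satisfying `Q`. -/
def Run (p : Prog) (s : State) (T : ℕ) (Q : State → Prop) : Prop :=
  ∃ s' t, Exec p s s' t ∧ t ≤ T ∧ Q s'

namespace Run

theorem mono {p : Prog} {s : State} {T U : ℕ} {Q R : State → Prop} (h : Run p s T Q) (hT : T ≤ U)
    (hQ : ∀ s', p.Frame s s' → Q s' → R s') : Run p s U R := by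
  obtain ⟨s', t, he, ht, hq⟩ := h
  exact ⟨s', t, he, ht.trans hT, hQ s' he.frame hq⟩

theorem skip {s : State} {Q : State → Prop} (h : Q s) : Run .skip s 1 Q :=
  ⟨_, _, .skip s, le_rfl, h⟩

theorem nset {s : State} {a : ℕ} {e : NExp} {Q : State → Prop} (h : Q (s.nset a (e.eval s))) :
    Run (.nset a e) s (e.cost + 1) Q :=
  ⟨_, _, .nset s a e, le_rfl, h⟩

theorem rset {s : State} {a : ℕ} {e : RExp} {Q : State → Prop} (h : Q (s.rset a (e.eval s))) :
    Run (.rset a e) s (e.cost + 1) Q :=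
  ⟨_, _, .rset s a e, le_rfl, h⟩

theorem nput {s : State} {a : ℕ} {i e : NExp} {Q : State → Prop}
    (h : Q (s.nput a (i.eval s) (e.eval s))) : Run (.nput a i e) s (i.cost + e.cost + 1) Q :=
  ⟨_, _, .nput s a i e, le_rfl, h⟩

theorem rput {s : State} {a : ℕ} {i : NExp} {e : RExp} {Q : State → Prop}
    (h : Q (s.rput a (i.eval s) (e.eval s))) : Run (.rput a i e) s (i.cost + e.cost + 1) Q :=
  ⟨_, _, .rput s a i e, le_rfl, h⟩

theorem seq {p q : Prog} {s : State} {T U : ℕ} {R Q : State → Prop} (h : Run p s T R)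
    (h' : ∀ s', p.Frame s s' → R s' → Run q s' U Q) : Run (.seq p q) s (T + U) Q := by
  obtain ⟨s', t, he, ht, hr⟩ := h
  obtain ⟨s'', u, he', hu, hq⟩ := h' s' he.frame hr
  exact ⟨s'', _, he.seq he', add_le_add ht hu, hq⟩

theorem ite {t : Test} {p q : Prog} {s : State} {T : ℕ} {Q : State → Prop}
    (h : t.Holds s → Run p s T Q) (h' : ¬ t.Holds s → Run q s T Q) :
    Run (.ite t p q) s (t.cost + T + 1) Q := by
  by_cases ht : t.Holds s
  · obtain ⟨s', u, he, hu, hq⟩ := h ht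
    exact ⟨s', _, .ite_true ht he, by omega, hq⟩
  · obtain ⟨s', u, he, hu, hq⟩ := h' ht
    exact ⟨s', _, .ite_false ht he, by omega, hq⟩

/-- A loop that makes at most `N` rounds. -/
theorem loop {t : Test} {p : Prog} {c : ℕ} (P : ℕ → State → Prop) (N : ℕ)
    (hstep : ∀ k s, P k s → t.Holds s → k < N ∧ Run p s c (P (k + 1))) {s : State} {k : ℕ}
    (hk : k ≤ N) (h : P k s) : Run (.loop t p) s ((N - k) * (t.cost + c + 1) + (t.cost + 1))
      (fun s' => ¬ t.Holds s' ∧ ∃ k, P k s') := by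
  induction hd : N - k generalizing s k with
  | zero =>
    have ht : ¬ t.Holds s := fun ht => by have := (hstep k s h ht).1; omega
    exact ⟨s, _, .loop_false ht, by omega, ht, k, h⟩
  | succ d ih =>
    by_cases ht : t.Holds s
    · obtain ⟨s', u, he, hu, hp⟩ := (hstep k s h ht).2
      obtain ⟨s'', u', he', hu', hq⟩ := ih (k := k + 1) (by omega) hp (by omega)
      refine ⟨s'', _, .loop_true ht he he', ?_, hq⟩
      rw [add_mul]; omega
    · exact ⟨s, _, .loop_false ht, by omega, ht, k, h⟩

end Run

/-- `for v < b do p`, where `b` is a variable. -/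
def forLoop (v b : ℕ) (p : Prog) : Prog :=
  .seq (.nset v (.lit 0)) (.loop (.nlt (.var v) (.var b))
    (.seq p (.nset v (.add (.var v) (.lit 1)))))

/-- A round costs `c` for the body, `4` for the increment, `3` for the test and `1` for the jump.
The `6` pays for the initialization and the failing test. -/
theorem Run.forLoop {v b : ℕ} {p : Prog} {s₀ : State} {c : ℕ} (P : ℕ → State → Prop) (hvb : v ≠ b)
    (hv : v ∉ p.nvars) (hb : b ∉ p.nvars) (h0 : P 0 (s₀.nset v 0))
    (hstep : ∀ k < s₀.nvar b, ∀ s, s.nvar v = k → (forLoop v b p).Frame s₀ s → P k s →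
      Run p s c (fun s' => P (k + 1) (s'.nset v (k + 1)))) :
    Run (forLoop v b p) s₀ (s₀.nvar b * (c + 8) + 6) (P (s₀.nvar b)) := by
  have hbF : b ∉ (LinfReg.forLoop v b p).nvars := by
    simp only [LinfReg.forLoop, Prog.nvars, List.mem_append, List.mem_singleton]
    tauto
  have hF0 : (LinfReg.forLoop v b p).Frame s₀ (s₀.nset v 0) :=
    (Exec.nset s₀ v (.lit 0)).frame.seq_left
  refine Run.mono (Run.seq (R := fun s => s = s₀.nset v 0) (T := 2)
    (U := s₀.nvar b * (c + 8) + 4) (Run.nset rfl) ?_) (by omega) (fun s' _ h => h)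
  rintro s - rfl
  have := Run.loop (t := .nlt (.var v) (.var b)) (p := .seq p (.nset v (.add (.var v) (.lit 1))))
    (c := c + 4)
    (fun k s => k ≤ s₀.nvar b ∧ s.nvar v = k ∧ (LinfReg.forLoop v b p).Frame s₀ s ∧ P k s)
    (s₀.nvar b) ?_ (s := s₀.nset v 0) (k := 0) (Nat.zero_le _)
    ⟨Nat.zero_le _, by simp [State.nset], hF0, h0⟩
  · refine this.mono ?_ ?_
    · rw [show (Test.nlt (.var v) (.var b)).cost = 3 from rfl, Nat.sub_zero]
      exact le_of_eq (by ring)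
    · rintro s' - ⟨ht, k, hk, hvk, hF, hP⟩
      simp only [Test.Holds, NExp.eval, hvk, hF.nvar b hbF] at ht
      rwa [show s₀.nvar b = k by omega]
  · rintro k s ⟨-, hvk, hF, hP⟩ ht
    simp only [Test.Holds, NExp.eval, hvk, hF.nvar b hbF] at ht
    refine ⟨ht, ?_⟩
    refine Run.seq (T := c) (U := 4) (hstep k ht s hvk hF hP) fun s' hs' hP' => Run.nset ?_
    have hvk' : s'.nvar v = k := (hs'.nvar v hv).trans hvk
    have e : (NExp.add (.var v) (.lit 1)).eval s' = k + 1 := by simp [NExp.eval, hvk']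
    rw [e]
    have h1 : (Prog.seq p (.nset v (.add (.var v) (.lit 1)))).Frame s' (s'.nset v (k + 1)) :=
      e ▸ (Exec.nset s' v (.add (.var v) (.lit 1))).frame.seq_right
    have h2 : (LinfReg.forLoop v b p).Frame s (s'.nset v (k + 1)) :=
      (hs'.seq_left.trans h1).mono (List.subset_append_right _ _)
        (List.subset_append_right _ _) (List.subset_append_right _ _) (List.subset_append_right _ _)
    exact ⟨ht, by simp [State.nset], hF.trans h2, hP'⟩

/-! ### Loops over arrays

The counter of these loops is variable number `5`. -/

/-- `a[i] := e` for `i < b`. -/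
def fill (a b : ℕ) (e : RExp) : Prog := forLoop 5 b (.rput a (.var 5) e)

/-- In `he` the current cell of `a` still has its initial contents, so `e` may read the cell it
overwrites; this allows updates in place. -/
theorem Run.fill {a b : ℕ} {e : RExp} {s₀ : State} {N : ℕ} (hN : s₀.nvar b = N) (hb : 5 ≠ b)
    (f : ℕ → ℝ)
    (he : ∀ s, (fill a b e).Frame s₀ s → s.nvar 5 < N →
      s.rarr a (s.nvar 5) = s₀.rarr a (s.nvar 5) → e.eval s = f (s.nvar 5)) :
    Run (fill a b e) s₀ (N * (e.cost + 10) + 6) (fun s' => ∀ i < N, s'.rarr a i = f i) := by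
  subst hN
  refine (Run.forLoop (c := e.cost + 2)
    (fun k s => (∀ i < k, s.rarr a i = f i) ∧ ∀ i, k ≤ i → s.rarr a i = s₀.rarr a i)
    hb (by simp [Prog.nvars]) (by simp [Prog.nvars]) ⟨by simp, fun _ _ => rfl⟩ ?_).mono
    (by rfl) fun s' _ h => h.1
  rintro k hk s hv hF ⟨h1, h2⟩
  subst hv
  refine (Run.rput ?_).mono (by simp only [NExp.cost]; omega) fun _ _ h => h
  have := he s hF hk (h2 _ le_rfl)
  constructor
  · intro i hi
    rcases eq_or_ne i (s.nvar 5) with rfl | hne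
    · simp [State.rput, State.nset, NExp.eval, this]
    · simp [State.rput, State.nset, NExp.eval, hne, h1 i (by omega)]
  · intro i hi
    simp [State.rput, State.nset, NExp.eval, show i ≠ s.nvar 5 by omega, h2 i (by omega)]

/-- `a[i] := max e f` for `i < b`. -/
def fillMax (a b : ℕ) (e f : RExp) : Prog :=
  forLoop 5 b (.ite (.rlt e f) (.rput a (.var 5) f) (.rput a (.var 5) e))

theorem Run.fillMax {a b : ℕ} {e f : RExp} {s₀ : State} {N : ℕ} (hN : s₀.nvar b = N) (hb : 5 ≠ b)
    (g h : ℕ → ℝ)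
    (he : ∀ s, (fillMax a b e f).Frame s₀ s → s.nvar 5 < N →
      s.rarr a (s.nvar 5) = s₀.rarr a (s.nvar 5) →
        e.eval s = g (s.nvar 5) ∧ f.eval s = h (s.nvar 5)) :
    Run (fillMax a b e f) s₀ (N * (2 * e.cost + 2 * f.cost + 12) + 6)
      (fun s' => ∀ i < N, s'.rarr a i = max (g i) (h i)) := by
  subst hN
  refine (Run.forLoop (c := 2 * e.cost + 2 * f.cost + 4)
    (fun k s => (∀ i < k, s.rarr a i = max (g i) (h i)) ∧ ∀ i, k ≤ i → s.rarr a i = s₀.rarr a i)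
    hb (by simp [Prog.nvars]) (by simp [Prog.nvars]) ⟨by simp, fun _ _ => rfl⟩ ?_).mono
    (by rfl) fun s' _ h => h.1
  rintro k hk s hv hF ⟨h1, h2⟩
  subst hv
  obtain ⟨h3, h4⟩ := he s hF hk (h2 _ le_rfl)
  have key : ∀ x : RExp, x.eval s = max (g (s.nvar 5)) (h (s.nvar 5)) →
      (∀ i < s.nvar 5 + 1, (((s.rput a (s.nvar 5) (x.eval s)).nset 5 (s.nvar 5 + 1)).rarr a i
        = max (g i) (h i))) ∧ ∀ i, s.nvar 5 + 1 ≤ i →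
        ((s.rput a (s.nvar 5) (x.eval s)).nset 5 (s.nvar 5 + 1)).rarr a i = s₀.rarr a i := by
    intro x hx
    constructor
    · intro i hi
      rcases eq_or_ne i (s.nvar 5) with rfl | hne
      · simp [State.rput, State.nset, hx]
      · simp [State.rput, State.nset, hne, h1 i (by omega)]
    · intro i hi
      simp [State.rput, State.nset, show i ≠ s.nvar 5 by omega, h2 i (by omega)]
  refine (Run.ite (T := e.cost + f.cost + 2) (fun ht => ?_) (fun ht => ?_)).mono
    (by simp only [Test.cost]; omega) fun _ _ h => h
  · refine (Run.rput ?_).mono (by simp only [NExp.cost]; omega) fun _ _ h => h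
    exact key f (by
      simp only [Test.Holds, h3, h4] at ht
      rw [h4, max_eq_right ht.le])
  · refine (Run.rput ?_).mono (by simp only [NExp.cost]; omega) fun _ _ h => h
    exact key e (by
      simp only [Test.Holds, h3, h4] at ht
      rw [h3, max_eq_left (not_lt.1 ht)])

/-- `a[c[k]] := a[c[k]] + e` for `k` below variable number `2`. -/
def scatter (a c : ℕ) (e : RExp) : Prog :=
  forLoop 5 2 (.rput a (.get c (.var 5)) (.add (.get a (.get c (.var 5))) e))

/-- One pass over the entries, adding each to the cell of its row or column: this is sparse
multiplication by the matrix or its transpose. -/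
theorem Run.scatter {a c : ℕ} {e : RExp} {s₀ : State} {N : ℕ} (hN : s₀.nvar 2 = N) (f : ℕ → ℝ)
    (he : ∀ s, (scatter a c e).Frame s₀ s → s.nvar 5 < N → e.eval s = f (s.nvar 5)) :
    Run (scatter a c e) s₀ (N * (e.cost + 15) + 6) (fun s' => ∀ i, s'.rarr a i
      = s₀.rarr a i + ∑ k ∈ Finset.range N, if s₀.narr c k = i then f k else 0) := by
  subst hN
  refine (Run.forLoop (c := e.cost + 7) (fun k s => ∀ i, s.rarr a i
      = s₀.rarr a i + ∑ k ∈ Finset.range k, if s₀.narr c k = i then f k else 0)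
    (by decide) (by simp [Prog.nvars]) (by simp [Prog.nvars]) (by simp [State.nset]) ?_).mono
    (by rfl) fun s' _ h => h
  rintro k hk s hv hF h1
  subst hv
  refine (Run.rput ?_).mono
    (by simp only [NExp.cost, RExp.cost]; omega) fun _ _ h => h
  intro i
  have hc : s.narr c = s₀.narr c :=
    hF.narr c (by simp [LinfReg.forLoop, Prog.narrs])
  rw [Finset.sum_range_succ]
  simp only [State.rput, State.nset, NExp.eval, RExp.eval, he s hF hk, hc, Function.update_self]
  rcases eq_or_ne i (s₀.narr c (s.nvar 5)) with rfl | hne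
  · simp [h1]; ring
  · simp [hne, hne.symm, h1]

/-- `z := ∑ e` over `k < b`. -/
def accum (z b : ℕ) (e : RExp) : Prog :=
  .seq (.rset z (.ofNat (.lit 0))) (forLoop 5 b (.rset z (.add (.var z) e)))

theorem Run.accum {z b : ℕ} {e : RExp} {s₀ : State} {N : ℕ} (hN : s₀.nvar b = N) (hb : 5 ≠ b)
    (f : ℕ → ℝ)
    (he : ∀ s, (accum z b e).Frame s₀ s → s.nvar 5 < N → e.eval s = f (s.nvar 5)) :
    Run (accum z b e) s₀ (N * (e.cost + 11) + 9)
      (fun s' => s'.rvar z = ∑ k ∈ Finset.range N, f k) := by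
  subst hN
  refine (Run.seq (T := 3) (U := s₀.nvar b * (e.cost + 11) + 6) (R := fun s => s = s₀.rset z 0)
    (Run.rset ?_) ?_).mono (by omega) fun _ _ h => h
  · simp [RExp.eval, NExp.eval]
  rintro s₁ hF₁ rfl
  refine (Run.forLoop (c := e.cost + 3) (fun k s => s.rvar z = ∑ k ∈ Finset.range k, f k)
    hb (by simp [Prog.nvars]) (by simp [Prog.nvars])
    (by simp [State.nset, State.rset]) ?_).mono (by rfl) fun s' _ h => h
  rintro k hk s hv hF h1
  subst hv
  refine (Run.rset ?_).mono
    (by simp only [RExp.cost]; omega) fun _ _ h => h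
  have hF' := hF₁.seq_left.trans hF.seq_right
  simp only [State.rset, State.nset, RExp.eval, he s hF' hk, Function.update_self, h1,
    Finset.sum_range_succ]

/-- `z := max 0 a[k]` over `k < b`. -/
def maximum (z b a : ℕ) : Prog :=
  .seq (.rset z (.ofNat (.lit 0))) (forLoop 5 b
    (.ite (.rlt (.var z) (.get a (.var 5))) (.rset z (.get a (.var 5))) .skip))

theorem Run.maximum {z b a : ℕ} {s₀ : State} {N : ℕ} (hN : s₀.nvar b = N) (hb : 5 ≠ b) :
    Run (maximum z b a) s₀ (N * 16 + 9) (fun s' => (∀ k < N, s₀.rarr a k ≤ s'.rvar z) ∧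
      (s'.rvar z = 0 ∨ ∃ k < N, s'.rvar z = s₀.rarr a k)) := by
  subst hN
  refine (Run.seq (T := 3) (U := s₀.nvar b * 16 + 6) (R := fun s => s = s₀.rset z 0)
    (Run.rset ?_) ?_).mono (by omega) fun _ _ h => h
  · simp [RExp.eval, NExp.eval]
  rintro s₁ hF₁ rfl
  refine (Run.forLoop (c := 8) (fun k s => (∀ i < k, s₀.rarr a i ≤ s.rvar z) ∧
      (s.rvar z = 0 ∨ ∃ i < k, s.rvar z = s₀.rarr a i))
    hb (by simp [Prog.nvars]) (by simp [Prog.nvars])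
    (by simp [State.nset, State.rset]) ?_).mono (by rfl) fun s' _ h => h
  rintro k hk s hv hF ⟨h1, h2⟩
  subst hv
  have ha : s.rarr a = s₀.rarr a := hF.rarr a (by simp [LinfReg.forLoop, Prog.rarrs])
  refine (Run.ite (T := 3) (fun ht => ?_) (fun ht => ?_)).mono
    (by simp only [Test.cost, RExp.cost, NExp.cost]; omega) fun _ _ h => h
  · refine (Run.rset ?_).mono (by simp only [NExp.cost, RExp.cost]; omega) fun _ _ h => h
    simp only [Test.Holds, RExp.eval, NExp.eval, ha] at ht
    simp only [State.rset, State.nset, RExp.eval, NExp.eval, ha, Function.update_self]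
    refine ⟨fun i hi => ?_, Or.inr ⟨_, Nat.lt_succ_self _, rfl⟩⟩
    rcases Nat.lt_succ_iff_lt_or_eq.1 hi with h | rfl
    · exact (h1 i h).trans ht.le
    · exact le_rfl
  · refine (Run.skip ?_).mono (by omega) fun _ _ h => h
    simp only [Test.Holds, RExp.eval, NExp.eval, ha, not_lt] at ht
    refine ⟨fun i hi => ?_, h2.imp id fun ⟨i, hi, h⟩ => ⟨i, by omega, h⟩⟩
    rcases Nat.lt_succ_iff_lt_or_eq.1 hi with h | rfl
    · exact h1 i h
    · exact ht

/-! ### Sparse matrices in memory -/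

section Sparse

variable {n m : ℕ} {A : Matrix (Fin n) (Fin m) ℝ}

theorem CSC.colPtr_mono (D : CSC A) {j j' : ℕ} (h : j ≤ j') (h' : j' ≤ m) :
    D.colPtr j ≤ D.colPtr j' := by
  induction j', h using Nat.le_induction with
  | base => rfl
  | succ k hk ih => exact (ih (by omega)).trans (D.colPtr_le ⟨k, by omega⟩)

/-- `col k` is the column of the `k`-th entry. -/
def CSC.IsColIdx (D : CSC A) (col : ℕ → ℕ) (N : ℕ) : Prop :=
  ∀ k < N, ∃ j : Fin m, col k = j ∧ D.colPtr j ≤ k ∧ k < D.colPtr (j + 1)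

/-- Storage positions correspond bijectively to nonzero entries, and zero entries contribute nothing
by `hg`. Every later computation with the matrix goes through this identity. -/
theorem CSC.sum_entries (D : CSC A) {col : ℕ → ℕ} (hcol : D.IsColIdx col (D.colPtr m))
    (g : ℕ → ℕ → ℝ → ℝ) (hg : ∀ i j, g i j 0 = 0) :
    ∑ k ∈ Finset.range (D.colPtr m), g (D.rowIdx k) (col k) (D.val k)
      = ∑ i : Fin n, ∑ j : Fin m, g i j (A i j) := by
  classical
  have hk : ∀ k ∈ Finset.range (D.colPtr m), ∃ q : Fin n × Fin m, D.rowIdx k = q.1 ∧ col k = q.2 ∧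
      D.val k = A q.1 q.2 ∧ A q.1 q.2 ≠ 0 ∧ D.colPtr q.2 ≤ k ∧ k < D.colPtr (q.2 + 1) := by
    intro k hk
    obtain ⟨j, h1, h2, h3⟩ := hcol k (Finset.mem_range.1 hk)
    obtain ⟨i, h4, h5, h6⟩ := D.sound j k h2 h3
    exact ⟨(i, j), h4, h1, h5, h6, h2, h3⟩
  choose q hrow hc hval hne hlo hhi using hk
  rw [← Fintype.sum_prod_type' (f := fun (i : Fin n) (j : Fin m) => g i j (A i j)),
    ← Finset.sum_filter_of_ne (p := fun q : Fin n × Fin m => A q.1 q.2 ≠ 0)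
      (fun q _ h h0 => h (by rw [h0, hg]))]
  refine Finset.sum_bij (q) (fun k hk => by simpa using hne k hk) ?_ ?_ ?_
  · intro k hk k' hk' h
    obtain ⟨l, -, hl⟩ := D.complete (q k hk).2 (q k hk).1 (hne k hk)
    rw [hl k ⟨hlo k hk, hhi k hk, hrow k hk⟩,
      hl k' ⟨h ▸ hlo k' hk', h ▸ hhi k' hk', h ▸ hrow k' hk'⟩]
  · rintro ⟨i, j⟩ h
    obtain ⟨k, ⟨h1, h2, h3⟩, -⟩ := D.complete j i (by simpa using h)
    have hk : k ∈ Finset.range (D.colPtr m) :=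
      Finset.mem_range.2 (h2.trans_le (D.colPtr_mono j.2 le_rfl))
    -- The columns agree because the position ranges of distinct columns are disjoint, by
    -- monotonicity of `colPtr`.
    refine ⟨k, hk, Prod.ext (Fin.ext ((hrow k hk).symm.trans h3)) (Fin.ext ?_)⟩
    by_contra hne'
    rcases lt_or_gt_of_ne hne' with hlt | hgt
    · exact absurd ((hhi k hk).trans_le ((D.colPtr_mono hlt j.2.le).trans h1)) (lt_irrefl _)
    · exact absurd
        (h2.trans_le ((D.colPtr_mono hgt (q k hk).2.2.le).trans (hlo k hk))) (lt_irrefl _)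
  · intro k hk
    rw [hrow k hk, hc k hk, hval k hk]

theorem CSC.colPtr_eq_nnz (D : CSC A) {col : ℕ → ℕ} (hcol : D.IsColIdx col (D.colPtr m)) :
    D.colPtr m = nnz A := by
  classical
  have h := D.sum_entries hcol (fun _ _ v => if v = 0 then 0 else 1) (by simp)
  have h1 : ∑ k ∈ Finset.range (D.colPtr m), (if D.val k = 0 then (0 : ℝ) else 1) = D.colPtr m := by
    rw [Finset.sum_congr rfl fun k hk => ?_, Finset.sum_const, Finset.card_range, nsmul_one]
    obtain ⟨j, -, h2, h3⟩ := hcol k (Finset.mem_range.1 hk)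
    obtain ⟨i, -, h5, h6⟩ := D.sound j k h2 h3
    rw [if_neg (h5 ▸ h6)]
  have h2 : (nnz A : ℝ) = ∑ i, ∑ j, if A i j = 0 then (0 : ℝ) else 1 := by
    rw [Finset.sum_comm, nnz, Nat.cast_sum]
    refine Finset.sum_congr rfl fun j _ => ?_
    rw [colNnz, Set.ncard_eq_toFinset_card', Finset.card_eq_sum_ones, Nat.cast_sum,
      Set.toFinset_ofPred, Finset.sum_filter]
    refine Finset.sum_congr rfl fun i _ => ?_
    by_cases h : A i j = 0 <;> simp [h]
  exact_mod_cast h1.symm.trans (h.trans h2.symm)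

/-- Computes the column index of every entry, with the number of entries in variable number `2`. -/
def findCols : Prog :=
  .seq (.nset 2 (.get 0 (.var 1))) <| .seq (.nset 8 (.add (.var 1) (.var 2))) <|
  .seq (.nset 6 (.lit 0)) <| .seq (.nset 7 (.lit 0)) <|
  forLoop 5 8 (.ite (.nlt (.var 7) (.get 0 (.add (.var 6) (.lit 1))))
    (.seq (.nput 2 (.var 7) (.var 6)) (.nset 7 (.add (.var 7) (.lit 1))))
    (.nset 6 (.add (.var 6) (.lit 1))))

/-- Every round either labels one entry or moves to the next column, so the two counters sum to the
number of rounds and `m + D.colPtr m` rounds suffice, even with empty columns. -/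
theorem Run.findCols (D : CSC A) {s₀ : State} (h1 : s₀.nvar 1 = m) (h0 : s₀.narr 0 = D.colPtr) :
    Run findCols s₀ (30 * (D.colPtr m + m) + 30) (fun s' => s'.nvar 2 = D.colPtr m ∧
      D.IsColIdx (s'.narr 2) (D.colPtr m)) := by
  set s₁ : State := (((s₀.nset 2 (D.colPtr m)).nset 8 (m + D.colPtr m)).nset 6 0).nset 7 0 with hs₁
  have hloop := Run.forLoop (v := 5) (b := 8) (s₀ := s₁) (c := 15)
    (p := .ite (.nlt (.var 7) (.get 0 (.add (.var 6) (.lit 1))))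
      (.seq (.nput 2 (.var 7) (.var 6)) (.nset 7 (.add (.var 7) (.lit 1))))
      (.nset 6 (.add (.var 6) (.lit 1))))
    (fun t s => s.nvar 6 + s.nvar 7 = t ∧ s.nvar 6 ≤ m ∧ D.colPtr (s.nvar 6) ≤ s.nvar 7 ∧
      (s.nvar 6 < m → s.nvar 7 ≤ D.colPtr (s.nvar 6 + 1)) ∧ D.IsColIdx (s.narr 2) (s.nvar 7))
    (by decide) (by decide) (by decide) ?_ ?_
  · have e1 : Exec (.nset 2 (.get 0 (.var 1))) s₀ (s₀.nset 2 (D.colPtr m)) 3 := by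
      have := Exec.nset s₀ 2 (.get 0 (.var 1))
      simpa only [NExp.eval, h1, h0, NExp.cost] using this
    have e2 : Exec (.nset 8 (.add (.var 1) (.var 2))) (s₀.nset 2 (D.colPtr m))
        ((s₀.nset 2 (D.colPtr m)).nset 8 (m + D.colPtr m)) 4 := by
      have := Exec.nset (s₀.nset 2 (D.colPtr m)) 8 (.add (.var 1) (.var 2))
      simpa [NExp.eval, State.nset, h1, NExp.cost] using this
    obtain ⟨s', t, he, ht, h2, h3, h4, h5, h6⟩ := hloop
    have h8 : s₁.nvar 8 = m + D.colPtr m := by simp [hs₁, State.nset]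
    rw [h8] at ht h2
    have hF := he.frame.nvar 2 (by decide)
    have hend : D.colPtr m ≤ s'.nvar 7 := by omega
    refine ⟨s', _, e1.seq (e2.seq ((Exec.nset _ 6 (.lit 0)).seq ((Exec.nset _ 7 (.lit 0)).seq he))),
      ?_, ?_, fun k hk => h6 k (hk.trans_le hend)⟩
    · simp only [NExp.cost]; omega
    · rw [hF]; simp [hs₁, State.nset]
  · simp [hs₁, State.nset, D.colPtr_zero, CSC.IsColIdx]
  · rintro t ht s - hF ⟨h2, h3, h4, h5, h6⟩
    have h8 : s₁.nvar 8 = m + D.colPtr m := by simp [hs₁, State.nset]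
    rw [h8] at ht
    have hc : s.narr 0 = D.colPtr := (hF.narr 0 (by decide)).trans (by simp [hs₁, State.nset, h0])
    have hlt : s.nvar 6 < m := by
      -- Being past the last column means that all entries are labelled, so the counters would
      -- already sum to the full number of rounds.
      refine lt_of_le_of_ne h3 fun h => ?_
      rw [h] at h4; omega
    refine (Run.ite (T := 8) (fun ht => ?_) (fun ht => ?_)).mono
      (by simp only [Test.cost, NExp.cost]; omega) fun _ _ h => h
    · refine (Run.seq (T := 3) (U := 4) (R := fun s' => s' = s.nput 2 (s.nvar 7) (s.nvar 6))
        (Run.nput (by simp [NExp.eval])) ?_).mono (by omega) fun _ _ h => h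
      rintro s' - rfl
      refine (Run.nset ?_).mono (by simp only [NExp.cost]; omega) fun _ _ h => h
      simp only [Test.Holds, NExp.eval, hc] at ht
      simp only [State.nset, State.nput, NExp.eval, Function.update_self, ne_eq, Nat.reduceEqDiff,
        not_false_eq_true, Function.update_of_ne]
      refine ⟨by omega, h3, by omega, fun _ => ht, fun k hk => ?_⟩
      rcases Nat.lt_succ_iff_lt_or_eq.1 hk with h | rfl
      · rw [Function.update_of_ne h.ne]; exact h6 k h
      · exact ⟨⟨_, hlt⟩, by simp, h4, ht⟩
    · refine (Run.nset ?_).mono (by simp only [NExp.cost]; omega) fun _ _ h => h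
      simp only [Test.Holds, NExp.eval, hc, not_lt] at ht
      simp only [State.nset, NExp.eval, Function.update_self, ne_eq, Nat.reduceEqDiff,
        not_false_eq_true, Function.update_of_ne]
      refine ⟨by omega, hlt, ht, fun h => (h5 hlt).trans (D.colPtr_mono (by omega) (by omega)), h6⟩

end Sparse

/-! ### One iteration as a program -/

/-- A numeral. -/
abbrev RExp.const (k : ℕ) : RExp := .ofNat (.lit k)

/-- The current cell of an array. -/
abbrev RExp.cell (a : ℕ) : RExp := .get a (.var 5)

/-- The row of the current entry. -/
abbrev NExp.row : NExp := .get 1 (.var 5)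

/-- The column of the current entry. -/
abbrev NExp.col : NExp := .get 2 (.var 5)

/-- Multiplies the strategies and their sums with the matrix. -/
def gather : Prog :=
  .seq (fill 16 1 (.const 0)) <| .seq (fill 17 1 (.const 0)) <| .seq (fill 18 0 (.const 0)) <|
  .seq (scatter 16 2 (.mul (.cell 4) (.sub (.add (.get 14 .row) (.get 12 .row))
    (.add (.get 15 .row) (.get 13 .row))))) <|
  .seq (scatter 17 2 (.mul (.cell 5) (.add (.get 12 .row) (.get 13 .row)))) <|
  scatter 18 1 (.mul (.cell 4) (.add (.get 11 .col) (.get 10 .col)))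

/-- Updates the box player's strategy. -/
def updateX : Prog :=
  .seq (fillMax 10 1 (.div (.cell 16) (.mul (.const 2) (.cell 17))) (.sub (.const 0) (.const 1))) <|
  .seq (fillMax 10 1 (.sub (.const 0) (.cell 10)) (.sub (.const 0) (.const 1))) <|
  .seq (fill 11 1 (.add (.cell 11) (.cell 10))) <| .seq (fill 19 0 (.const 0)) <|
  scatter 19 1 (.mul (.cell 5) (.mul (.get 10 .col) (.get 10 .col)))

/-- Updates the simplex player's strategy. -/
def updateY : Prog :=
  .seq (fill 12 0 (.exp (.div (.sub (.add (.cell 18)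
    (.mul (.add (.ofNat (.var 4)) (.const 1)) (.cell 8))) (.cell 19)) (.const 120)))) <|
  .seq (fill 13 0 (.exp (.div (.sub (.add (.sub (.const 0) (.cell 18))
    (.mul (.add (.ofNat (.var 4)) (.const 1)) (.cell 9))) (.cell 19)) (.const 120)))) <|
  .seq (accum 5 0 (.add (.cell 12) (.cell 13))) <|
  .seq (fill 12 0 (.div (.cell 12) (.var 5))) <| .seq (fill 13 0 (.div (.cell 13) (.var 5))) <|
  .seq (fill 14 0 (.add (.cell 14) (.cell 12))) (fill 15 0 (.add (.cell 15) (.cell 13)))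

/-- One iteration. -/
def iteration : Prog := .seq gather (.seq updateX updateY)

section Iteration

variable {n m : ℕ}

/-- The scaled matrix and the offsets are in memory. -/
structure Ready (B : Matrix (Fin n) (Fin m) ℝ) (d : Fin n ⊕ Fin n → ℝ) (N : ℕ) (s : State) :
    Prop where
  rows : s.nvar 0 = n
  cols : s.nvar 1 = m
  entries : s.nvar 2 = N
  sum_entries : ∀ g : ℕ → ℕ → ℝ → ℝ, (∀ i j, g i j 0 = 0) →
    ∑ k ∈ Finset.range N, g (s.narr 1 k) (s.narr 2 k) (s.rarr 4 k)
      = ∑ i : Fin n, ∑ j : Fin m, g i j (B i j)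
  abs_entries : ∀ k < N, s.rarr 5 k = |s.rarr 4 k|
  offset_inl : ∀ i : Fin n, s.rarr 8 i = d (Sum.inl i)
  offset_inr : ∀ i : Fin n, s.rarr 9 i = d (Sum.inr i)

theorem Ready.of_frame {B : Matrix (Fin n) (Fin m) ℝ} {d : Fin n ⊕ Fin n → ℝ} {N : ℕ}
    {p : Prog} {s s' : State} (h : Ready B d N s) (hF : p.Frame s s')
    (h1 : ∀ a ∈ [0, 1, 2], a ∉ p.nvars) (h2 : ∀ a ∈ [1, 2], a ∉ p.narrs)
    (h3 : ∀ a ∈ [4, 5, 8, 9], a ∉ p.rarrs) : Ready B d N s' := by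
  have e4 := hF.rarr 4 (h3 4 (by decide))
  have e5 := hF.rarr 5 (h3 5 (by decide))
  have e8 := hF.rarr 8 (h3 8 (by decide))
  have e9 := hF.rarr 9 (h3 9 (by decide))
  have r1 := hF.narr 1 (h2 1 (by decide))
  have r2 := hF.narr 2 (h2 2 (by decide))
  exact ⟨(hF.nvar 0 (h1 0 (by decide))).trans h.rows, (hF.nvar 1 (h1 1 (by decide))).trans h.cols,
    (hF.nvar 2 (h1 2 (by decide))).trans h.entries, by rw [e4, r1, r2]; exact h.sum_entries,
    by rw [e4, e5]; exact h.abs_entries, by rw [e8]; exact h.offset_inl,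
    by rw [e9]; exact h.offset_inr⟩

/-- The state of the method is in memory. -/
structure Stores (P : Play (Fin n ⊕ Fin n) (Fin m)) (s : State) : Prop where
  x : ∀ j : Fin m, s.rarr 10 j = P.x j
  X : ∀ j : Fin m, s.rarr 11 j = P.X j
  y_inl : ∀ i : Fin n, s.rarr 12 i = P.y (Sum.inl i)
  y_inr : ∀ i : Fin n, s.rarr 13 i = P.y (Sum.inr i)
  Y_inl : ∀ i : Fin n, s.rarr 14 i = P.Y (Sum.inl i)
  Y_inr : ∀ i : Fin n, s.rarr 15 i = P.Y (Sum.inr i)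

variable {B : Matrix (Fin n) (Fin m) ℝ} {d : Fin n ⊕ Fin n → ℝ} {N : ℕ}
  {P : Play (Fin n ⊕ Fin n) (Fin m)}

theorem Ready.sum_col {s : State} (h : Ready B d N s) (g : ℕ → ℝ → ℝ) (hg : ∀ i, g i 0 = 0)
    (j : Fin m) : (∑ k ∈ Finset.range N, if s.narr 2 k = j then g (s.narr 1 k) (s.rarr 4 k) else 0)
      = ∑ i : Fin n, g i (B i j) := by
  rw [h.sum_entries (fun i j' v => if j' = j then g i v else 0) (fun i j' => by simp [hg])]
  refine Finset.sum_congr rfl fun i _ => ?_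
  simp [Fin.val_inj]

theorem Ready.sum_row {s : State} (h : Ready B d N s) (g : ℕ → ℝ → ℝ) (hg : ∀ j, g j 0 = 0)
    (i : Fin n) : (∑ k ∈ Finset.range N, if s.narr 1 k = i then g (s.narr 2 k) (s.rarr 4 k) else 0)
      = ∑ j : Fin m, g j (B i j) := by
  rw [h.sum_entries (fun i' j v => if i' = i then g j v else 0) (fun i' j => by simp [hg]),
    Finset.sum_comm]
  refine Finset.sum_congr rfl fun j _ => ?_
  simp [Fin.val_inj]

/-- Only `B` is stored. The signed copies enter as a difference of the two halves of `y` in the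
payoff, and as their sum with absolute values. -/
theorem Run.gather {s₀ : State} (h : Ready B d N s₀) (hP : Stores P s₀) :
    Run gather s₀ (200 * (n + m + N + 1)) (fun s =>
      (∀ j : Fin m, s.rarr 16 j = ((P.Y + P.y) ᵥ* signedRows B) j) ∧
      (∀ j : Fin m, s.rarr 17 j = (P.y ᵥ* absMat (signedRows B)) j) ∧
      ∀ i : Fin n, s.rarr 18 i = (B *ᵥ (P.X + P.x)) i) := by
  obtain ⟨s₁, t₁, e₁, l₁, h₁⟩ := Run.fill (a := 16) (e := .const 0) h.cols (by decide) (fun _ => 0)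
    (fun s _ _ _ => by simp [RExp.eval, NExp.eval])
  have F₁ := e₁.frame
  have R₁ := h.of_frame F₁ (by decide) (by decide) (by decide)
  obtain ⟨s₂, t₂, e₂, l₂, h₂⟩ := Run.fill (a := 17) (e := .const 0) R₁.cols (by decide) (fun _ => 0)
    (fun s _ _ _ => by simp [RExp.eval, NExp.eval])
  have F₂ := e₂.frame
  have R₂ := R₁.of_frame F₂ (by decide) (by decide) (by decide)
  obtain ⟨s₃, t₃, e₃, l₃, h₃⟩ := Run.fill (a := 18) (e := .const 0) R₂.rows (by decide) (fun _ => 0)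
    (fun s _ _ _ => by simp [RExp.eval, NExp.eval])
  have F₃ := e₃.frame
  have R₃ := R₂.of_frame F₃ (by decide) (by decide) (by decide)
  have E : ∀ a ∉ [16, 17, 18], s₃.rarr a = s₀.rarr a := fun a ha => by
    simp only [List.mem_cons, not_or] at ha
    rw [F₃.rarr a (by simp [LinfReg.fill, LinfReg.forLoop, Prog.rarrs]; tauto),
      F₂.rarr a (by simp [LinfReg.fill, LinfReg.forLoop, Prog.rarrs]; tauto),
      F₁.rarr a (by simp [LinfReg.fill, LinfReg.forLoop, Prog.rarrs]; tauto)]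
  obtain ⟨s₄, t₄, e₄, l₄, h₄⟩ := Run.scatter (a := 16) (c := 2)
    (e := .mul (.cell 4) (.sub (.add (.get 14 .row) (.get 12 .row))
      (.add (.get 15 .row) (.get 13 .row)))) R₃.entries
    (fun k => s₃.rarr 4 k * ((s₀.rarr 14 (s₃.narr 1 k) + s₀.rarr 12 (s₃.narr 1 k))
      - (s₀.rarr 15 (s₃.narr 1 k) + s₀.rarr 13 (s₃.narr 1 k)))) (fun s hF _ => by
        simp only [RExp.eval, NExp.eval, hF.rarr 4 (by decide), hF.rarr 12 (by decide),
          hF.rarr 13 (by decide), hF.rarr 14 (by decide), hF.rarr 15 (by decide),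
          hF.narr 1 (by decide), E 12 (by decide), E 13 (by decide), E 14 (by decide),
          E 15 (by decide)])
  have F₄ := e₄.frame
  have R₄ := R₃.of_frame F₄ (by decide) (by decide) (by decide)
  obtain ⟨s₅, t₅, e₅, l₅, h₅⟩ := Run.scatter (a := 17) (c := 2)
    (e := .mul (.cell 5) (.add (.get 12 .row) (.get 13 .row))) R₄.entries
    (fun k => |s₄.rarr 4 k| * (s₀.rarr 12 (s₄.narr 1 k) + s₀.rarr 13 (s₄.narr 1 k)))
    (fun s hF hk => by
        simp only [RExp.eval, NExp.eval, hF.rarr 5 (by decide), hF.rarr 12 (by decide),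
          hF.rarr 13 (by decide), F₄.rarr 12 (by decide), F₄.rarr 13 (by decide),
          hF.narr 1 (by decide), E 12 (by decide), E 13 (by decide), R₄.abs_entries _ hk])
  have F₅ := e₅.frame
  have R₅ := R₄.of_frame F₅ (by decide) (by decide) (by decide)
  obtain ⟨s₆, t₆, e₆, l₆, h₆⟩ := Run.scatter (a := 18) (c := 1)
    (e := .mul (.cell 4) (.add (.get 11 .col) (.get 10 .col))) R₅.entries
    (fun k => s₅.rarr 4 k * (s₀.rarr 11 (s₅.narr 2 k) + s₀.rarr 10 (s₅.narr 2 k)))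
    (fun s hF _ => by
        simp only [RExp.eval, NExp.eval, hF.rarr 4 (by decide), hF.rarr 10 (by decide),
          hF.rarr 11 (by decide), F₅.rarr 10 (by decide), F₅.rarr 11 (by decide),
          F₄.rarr 10 (by decide), F₄.rarr 11 (by decide),
          hF.narr 2 (by decide), E 10 (by decide), E 11 (by decide)])
  have F₆ := e₆.frame
  refine ⟨s₆, _, e₁.seq (e₂.seq (e₃.seq (e₄.seq (e₅.seq e₆)))), ?_, ?_, ?_, ?_⟩
  · simp only [RExp.cost, NExp.cost] at l₁ l₂ l₃ l₄ l₅ l₆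
    omega
  · intro j
    rw [F₆.rarr 16 (by decide), F₅.rarr 16 (by decide), h₄, F₃.rarr 16 (by decide),
      F₂.rarr 16 (by decide), h₁ _ j.2, R₃.sum_col (fun i v => v * ((s₀.rarr 14 i + s₀.rarr 12 i)
      - (s₀.rarr 15 i + s₀.rarr 13 i))) (by simp), zero_add]
    simp only [Matrix.vecMul, dotProduct, Fintype.sum_sum_type, signedRows,
      Matrix.fromRows_apply_inl,
      Matrix.fromRows_apply_inr, Pi.add_apply, Matrix.neg_apply, hP.y_inl, hP.y_inr, hP.Y_inl,
      hP.Y_inr, ← Finset.sum_add_distrib]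
    exact Finset.sum_congr rfl fun i _ => by ring
  · intro j
    rw [F₆.rarr 17 (by decide), h₅, F₄.rarr 17 (by decide), F₃.rarr 17 (by decide),
      h₂ _ j.2, R₄.sum_col (fun i v => |v| * (s₀.rarr 12 i + s₀.rarr 13 i)) (by simp), zero_add]
    simp only [Matrix.vecMul, dotProduct, Fintype.sum_sum_type, signedRows,
      Matrix.fromRows_apply_inl,
      Matrix.fromRows_apply_inr, Matrix.neg_apply, hP.y_inl, hP.y_inr, absMat, abs_neg,
      ← Finset.sum_add_distrib]
    exact Finset.sum_congr rfl fun i _ => by ring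
  · intro i
    rw [h₆, F₅.rarr 18 (by decide), F₄.rarr 18 (by decide),
      h₃ _ i.2, R₅.sum_row (fun j v => v * (s₀.rarr 11 j + s₀.rarr 10 j)) (by simp), zero_add]
    simp only [Matrix.mulVec, dotProduct, hP.x, hP.X, Pi.add_apply]

/-- Clipping is done by two maxima with `-1` and a sign change between them, since `min t 1 = -max
(-t) (-1)`. A zero denominator gives the same default quotient as in `clip`. -/
theorem Run.updateX {s₀ : State} (h : Ready B d N s₀) {p w X : Fin m → ℝ}
    (hp : ∀ j : Fin m, s₀.rarr 16 j = p j) (hw : ∀ j : Fin m, s₀.rarr 17 j = w j)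
    (hX : ∀ j : Fin m, s₀.rarr 11 j = X j) :
    let x : Fin m → ℝ := fun j => clip (-p j / (2 * w j))
    Run updateX s₀ (200 * (n + m + N + 1)) (fun s =>
      (∀ j : Fin m, s.rarr 10 j = x j) ∧ (∀ j : Fin m, s.rarr 11 j = (X + x) j) ∧
      ∀ i : Fin n, s.rarr 19 i = (absMat B *ᵥ (x * x)) i) := by
  intro x
  obtain ⟨s₁, t₁, e₁, l₁, h₁⟩ := Run.fillMax (a := 10)
    (e := .div (.cell 16) (.mul (.const 2) (.cell 17))) (f := .sub (.const 0) (.const 1)) h.cols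
    (by decide) (fun j => s₀.rarr 16 j / (2 * s₀.rarr 17 j)) (fun _ => -1)
    (fun s hF _ _ => by
      simp [RExp.eval, NExp.eval, hF.rarr 16 (by decide), hF.rarr 17 (by decide)])
  have F₁ := e₁.frame
  have R₁ := h.of_frame F₁ (by decide) (by decide) (by decide)
  obtain ⟨s₂, t₂, e₂, l₂, h₂⟩ := Run.fillMax (a := 10)
    (e := .sub (.const 0) (.cell 10)) (f := .sub (.const 0) (.const 1)) R₁.cols
    (by decide) (fun j => -s₁.rarr 10 j) (fun _ => -1)
    (fun s hF _ he => by simp [RExp.eval, NExp.eval, he])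
  have F₂ := e₂.frame
  have R₂ := R₁.of_frame F₂ (by decide) (by decide) (by decide)
  have hx : ∀ j : Fin m, s₂.rarr 10 j = x j := fun j => by
    rw [h₂ _ j.2, h₁ _ j.2, hp, hw]
    simp only [x, clip]
    rw [neg_div, max_comm, ← min_neg_neg, neg_neg]
  obtain ⟨s₃, t₃, e₃, l₃, h₃⟩ := Run.fill (a := 11) (e := .add (.cell 11) (.cell 10)) R₂.cols
    (by decide) (fun j => s₂.rarr 11 j + s₂.rarr 10 j)
    (fun s hF _ he => by simp [RExp.eval, NExp.eval, he, hF.rarr 10 (by decide)])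
  have F₃ := e₃.frame
  have R₃ := R₂.of_frame F₃ (by decide) (by decide) (by decide)
  obtain ⟨s₄, t₄, e₄, l₄, h₄⟩ := Run.fill (a := 19) (e := .const 0) R₃.rows (by decide) (fun _ => 0)
    (fun s _ _ _ => by simp [RExp.eval, NExp.eval])
  have F₄ := e₄.frame
  have R₄ := R₃.of_frame F₄ (by decide) (by decide) (by decide)
  obtain ⟨s₅, t₅, e₅, l₅, h₅⟩ := Run.scatter (a := 19) (c := 1)
    (e := .mul (.cell 5) (.mul (.get 10 .col) (.get 10 .col))) R₄.entries
    (fun k => |s₄.rarr 4 k| * (s₂.rarr 10 (s₄.narr 2 k) * s₂.rarr 10 (s₄.narr 2 k)))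
    (fun s hF hk => by
        simp only [RExp.eval, NExp.eval, hF.rarr 5 (by decide), hF.rarr 10 (by decide),
          F₄.rarr 10 (by decide), F₃.rarr 10 (by decide), hF.narr 2 (by decide),
          R₄.abs_entries _ hk])
  have F₅ := e₅.frame
  refine ⟨s₅, _, e₁.seq (e₂.seq (e₃.seq (e₄.seq e₅))), ?_, fun j => ?_, fun j => ?_, fun i => ?_⟩
  · simp only [RExp.cost, NExp.cost] at l₁ l₂ l₃ l₄ l₅
    omega
  · rw [F₅.rarr 10 (by decide), F₄.rarr 10 (by decide), F₃.rarr 10 (by decide), hx]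
  · rw [F₅.rarr 11 (by decide), F₄.rarr 11 (by decide), h₃ _ j.2, hx, F₂.rarr 11 (by decide),
      F₁.rarr 11 (by decide), hX, Pi.add_apply]
  · rw [h₅, h₄ _ i.2, R₄.sum_row (fun j v => |v| * (s₂.rarr 10 j * s₂.rarr 10 j)) (by simp),
      zero_add]
    simp only [Matrix.mulVec, dotProduct, hx, Pi.mul_apply, absMat]

theorem Run.updateY {s₀ : State} (h : Ready B d N s₀) {a e : Fin n → ℝ} {Y : Fin n ⊕ Fin n → ℝ}
    (ha : ∀ i : Fin n, s₀.rarr 18 i = a i) (he : ∀ i : Fin n, s₀.rarr 19 i = e i)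
    (hl : ∀ i : Fin n, s₀.rarr 14 i = Y (Sum.inl i))
    (hr : ∀ i : Fin n, s₀.rarr 15 i = Y (Sum.inr i)) :
    let y : Fin n ⊕ Fin n → ℝ := softmax
      (Sum.elim (fun i => (a i + (s₀.nvar 4 + 1) * d (Sum.inl i) - e i) / 120)
        (fun i => (-a i + (s₀.nvar 4 + 1) * d (Sum.inr i) - e i) / 120))
    Run updateY s₀ (200 * (n + m + N + 1)) (fun s =>
      (∀ i : Fin n, s.rarr 12 i = y (Sum.inl i)) ∧ (∀ i : Fin n, s.rarr 13 i = y (Sum.inr i)) ∧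
      (∀ i : Fin n, s.rarr 14 i = (Y + y) (Sum.inl i)) ∧
      ∀ i : Fin n, s.rarr 15 i = (Y + y) (Sum.inr i)) := by
  intro y
  obtain ⟨s₁, t₁, e₁, l₁, h₁⟩ := Run.fill (a := 12)
    (e := .exp (.div (.sub (.add (.cell 18)
      (.mul (.add (.ofNat (.var 4)) (.const 1)) (.cell 8))) (.cell 19)) (.const 120))) h.rows
    (by decide) (fun i => Real.exp
      ((s₀.rarr 18 i + (s₀.nvar 4 + 1) * s₀.rarr 8 i - s₀.rarr 19 i) / 120))
    (fun s hF _ _ => by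
      simp [RExp.eval, NExp.eval, hF.rarr 18 (by decide), hF.rarr 8 (by decide),
        hF.rarr 19 (by decide), hF.nvar 4 (by decide)])
  have F₁ := e₁.frame
  have R₁ := h.of_frame F₁ (by decide) (by decide) (by decide)
  obtain ⟨s₂, t₂, e₂, l₂, h₂⟩ := Run.fill (a := 13)
    (e := .exp (.div (.sub (.add (.sub (.const 0) (.cell 18))
      (.mul (.add (.ofNat (.var 4)) (.const 1)) (.cell 9))) (.cell 19)) (.const 120))) R₁.rows
    (by decide) (fun i => Real.exp
      ((-s₀.rarr 18 i + (s₀.nvar 4 + 1) * s₀.rarr 9 i - s₀.rarr 19 i) / 120))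
    (fun s hF _ _ => by
      simp [RExp.eval, NExp.eval, hF.rarr 18 (by decide), hF.rarr 9 (by decide),
        hF.rarr 19 (by decide), hF.nvar 4 (by decide), F₁.rarr 18 (by decide),
        F₁.rarr 9 (by decide), F₁.rarr 19 (by decide), F₁.nvar 4 (by decide)])
  have F₂ := e₂.frame
  have R₂ := R₁.of_frame F₂ (by decide) (by decide) (by decide)
  obtain ⟨s₃, t₃, e₃, l₃, h₃⟩ := Run.accum (z := 5) (e := .add (.cell 12) (.cell 13)) R₂.rows
    (by decide) (fun i => s₂.rarr 12 i + s₂.rarr 13 i)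
    (fun s hF _ => by
      simp [RExp.eval, NExp.eval, hF.rarr 12 (by decide), hF.rarr 13 (by decide)])
  have F₃ := e₃.frame
  have R₃ := R₂.of_frame F₃ (by decide) (by decide) (by decide)
  obtain ⟨s₄, t₄, e₄, l₄, h₄⟩ := Run.fill (a := 12) (e := .div (.cell 12) (.var 5)) R₃.rows
    (by decide) (fun i => s₃.rarr 12 i / s₃.rvar 5)
    (fun s hF _ he => by simp [RExp.eval, NExp.eval, he, hF.rvar 5 (by decide)])
  have F₄ := e₄.frame
  have R₄ := R₃.of_frame F₄ (by decide) (by decide) (by decide)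
  obtain ⟨s₅, t₅, e₅, l₅, h₅⟩ := Run.fill (a := 13) (e := .div (.cell 13) (.var 5)) R₄.rows
    (by decide) (fun i => s₄.rarr 13 i / s₄.rvar 5)
    (fun s hF _ he => by simp [RExp.eval, NExp.eval, he, hF.rvar 5 (by decide)])
  have F₅ := e₅.frame
  have R₅ := R₄.of_frame F₅ (by decide) (by decide) (by decide)
  obtain ⟨s₆, t₆, e₆, l₆, h₆⟩ := Run.fill (a := 14) (e := .add (.cell 14) (.cell 12)) R₅.rows
    (by decide) (fun i => s₅.rarr 14 i + s₅.rarr 12 i)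
    (fun s hF _ he => by simp [RExp.eval, NExp.eval, he, hF.rarr 12 (by decide)])
  have F₆ := e₆.frame
  have R₆ := R₅.of_frame F₆ (by decide) (by decide) (by decide)
  obtain ⟨s₇, t₇, e₇, l₇, h₇⟩ := Run.fill (a := 15) (e := .add (.cell 15) (.cell 13)) R₆.rows
    (by decide) (fun i => s₆.rarr 15 i + s₆.rarr 13 i)
    (fun s hF _ he => by simp [RExp.eval, NExp.eval, he, hF.rarr 13 (by decide)])
  have F₇ := e₇.frame
  set f : Fin n ⊕ Fin n → ℝ :=
    Sum.elim (fun i => (a i + (s₀.nvar 4 + 1) * d (Sum.inl i) - e i) / 120)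
      (fun i => (-a i + (s₀.nvar 4 + 1) * d (Sum.inr i) - e i) / 120) with hf
  have q1 : ∀ i : Fin n, s₂.rarr 12 i = Real.exp (f (Sum.inl i)) := fun i => by
    rw [F₂.rarr 12 (by decide), h₁ _ i.2, ha, he, h.offset_inl]; rfl
  have q2 : ∀ i : Fin n, s₂.rarr 13 i = Real.exp (f (Sum.inr i)) := fun i => by
    rw [h₂ _ i.2, ha, he, h.offset_inr]; rfl
  have hZ : s₃.rvar 5 = ∑ k, Real.exp (f k) := by
    rw [h₃, Finset.sum_range, Fintype.sum_sum_type, ← Finset.sum_add_distrib]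
    exact Finset.sum_congr rfl fun i _ => by rw [q1, q2]
  have y1 : ∀ i : Fin n, s₅.rarr 12 i = y (Sum.inl i) := fun i => by
    rw [F₅.rarr 12 (by decide), h₄ _ i.2, F₃.rarr 12 (by decide), q1, hZ]; rfl
  have y2 : ∀ i : Fin n, s₅.rarr 13 i = y (Sum.inr i) := fun i => by
    rw [h₅ _ i.2, F₄.rarr 13 (by decide), F₃.rarr 13 (by decide), q2, F₄.rvar 5 (by decide), hZ]
    rfl
  refine ⟨s₇, _, e₁.seq (e₂.seq (e₃.seq (e₄.seq (e₅.seq (e₆.seq e₇))))), ?_, fun i => ?_,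
    fun i => ?_, fun i => ?_, fun i => ?_⟩
  · simp only [RExp.cost, NExp.cost] at l₁ l₂ l₃ l₄ l₅ l₆ l₇
    omega
  · rw [F₇.rarr 12 (by decide), F₆.rarr 12 (by decide), y1]
  · rw [F₇.rarr 13 (by decide), F₆.rarr 13 (by decide), y2]
  · rw [F₇.rarr 14 (by decide), h₆ _ i.2, y1, F₅.rarr 14 (by decide), F₄.rarr 14 (by decide),
      F₃.rarr 14 (by decide), F₂.rarr 14 (by decide), F₁.rarr 14 (by decide), hl, Pi.add_apply]
  · rw [h₇ _ i.2, F₆.rarr 13 (by decide), y2, F₆.rarr 15 (by decide), F₅.rarr 15 (by decide),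
      F₄.rarr 15 (by decide), F₃.rarr 15 (by decide), F₂.rarr 15 (by decide),
      F₁.rarr 15 (by decide), hr, Pi.add_apply]

theorem Run.iteration {s₀ : State} (h : Ready B d N s₀) (hP : Stores P s₀) :
    Run iteration s₀ (600 * (n + m + N + 1))
      (Stores (P.next (signedRows B) d (s₀.nvar 4))) := by
  obtain ⟨s₁, t₁, e₁, l₁, h₁, h₁', h₁''⟩ := Run.gather h hP
  have F₁ := e₁.frame
  have R₁ := h.of_frame F₁ (by decide) (by decide) (by decide)
  obtain ⟨s₂, t₂, e₂, l₂, h₂, h₂', h₂''⟩ := Run.updateX R₁ h₁ h₁' (X := P.X)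
    (fun j => by rw [F₁.rarr 11 (by decide), hP.X])
  have F₂ := e₂.frame
  have R₂ := R₁.of_frame F₂ (by decide) (by decide) (by decide)
  obtain ⟨s₃, t₃, e₃, l₃, h₃, h₃', h₃'', h₃'''⟩ := Run.updateY R₂
    (fun i => by rw [F₂.rarr 18 (by decide), h₁'']) h₂'' (Y := P.Y)
    (fun i => by rw [F₂.rarr 14 (by decide), F₁.rarr 14 (by decide), hP.Y_inl])
    (fun i => by rw [F₂.rarr 15 (by decide), F₁.rarr 15 (by decide), hP.Y_inr])
  have F₃ := e₃.frame
  have hlogit : (Sum.elim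
      (fun i => ((B *ᵥ (P.X + P.x)) i + (s₂.nvar 4 + 1) * d (Sum.inl i)
        - (absMat B *ᵥ (P.nextX (signedRows B) * P.nextX (signedRows B))) i) / 120)
      (fun i => (-(B *ᵥ (P.X + P.x)) i + (s₂.nvar 4 + 1) * d (Sum.inr i)
        - (absMat B *ᵥ (P.nextX (signedRows B) * P.nextX (signedRows B))) i) / 120))
      = P.logit (signedRows B) d (s₀.nvar 4) := by
    have e4 : s₂.nvar 4 = s₀.nvar 4 :=
      (F₂.nvar 4 (by decide)).trans (F₁.nvar 4 (by decide))
    -- Both signs have the same absolute values, so one array serves the quadratic term of both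
    -- halves.
    have habs : absMat (signedRows B) = Matrix.fromRows (absMat B) (absMat B) := by
      ext i j; cases i <;> simp [absMat, signedRows]
    funext i
    rw [Play.logit, habs]
    cases i <;> simp [signedRows, e4, Matrix.fromRows_mulVec, Matrix.neg_mulVec]
  have hy := congrArg softmax hlogit
  refine ⟨s₃, _, e₁.seq (e₂.seq e₃), by omega, fun j => ?_, fun j => ?_, fun i => ?_, fun i => ?_,
    fun i => ?_, fun i => ?_⟩
  · rw [F₃.rarr 10 (by decide), h₂]; rfl
  · rw [F₃.rarr 11 (by decide), h₂']; rfl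
  · rw [h₃]; exact congrFun hy _
  · rw [h₃']; exact congrFun hy _
  · rw [h₃'']; exact congrArg (P.Y (Sum.inl i) + ·) (congrFun hy _)
  · rw [h₃''']; exact congrArg (P.Y (Sum.inr i) + ·) (congrFun hy _)

end Iteration

/-! ### The whole program -/

/-- Divides the matrix by its norm, which is put into variable number `2`, and puts the product
with the radius into variable number `3`. -/
def scaleMatrix : Prog :=
  .seq (fillMax 5 2 (.cell 0) (.sub (.const 0) (.cell 0))) <| .seq (fill 6 0 (.const 0)) <|
  .seq (scatter 6 1 (.cell 5)) <| .seq (maximum 2 0 6) <|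
  .seq (fill 4 2 (.div (.cell 0) (.var 2))) <| .seq (fill 5 2 (.div (.cell 5) (.var 2))) <|
  .rset 3 (.mul (.var 0) (.var 2))

/-- Computes the offsets of the rows. -/
def computeOffsets : Prog :=
  .seq (fill 7 0 (.div (.cell 1) (.var 3))) <|
  .seq (scatter 7 1 (.div (.mul (.sub (.const 0) (.cell 4)) (.get 2 .col)) (.var 0))) <|
  .seq (fillMax 6 0 (.cell 7) (.sub (.const 0) (.cell 7))) <| .seq (maximum 4 0 6) <|
  .seq (fillMax 8 0 (.sub (.sub (.const 0) (.cell 7)) (.var 4)) (.sub (.const 0) (.const 2))) <|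
  fillMax 9 0 (.sub (.cell 7) (.var 4)) (.sub (.const 0) (.const 2))

/-- Computes the number of iterations. -/
def countRounds : Prog :=
  .seq (.rset 5 (.div (.mul (.add (.const 30) (.mul (.const 120)
    (.log (.mul (.const 2) (.ofNat (.var 0)))))) (.var 3)) (.var 1))) <|
  .seq (.nset 3 (.lit 0)) <|
  .loop (.rlt (.ofNat (.var 3)) (.var 5)) (.nset 3 (.add (.var 3) (.lit 1)))

/-- Stores the initial strategies. -/
def initStrategies : Prog :=
  .seq (fill 10 1 (.const 0)) <| .seq (fill 11 1 (.const 0)) <|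
  .seq (fill 12 0 (.div (.const 1) (.mul (.const 2) (.ofNat (.var 0))))) <|
  .seq (fill 13 0 (.div (.const 1) (.mul (.const 2) (.ofNat (.var 0))))) <|
  .seq (fill 14 0 (.const 0)) (fill 15 0 (.const 0))

/-- The algorithm for `ℓ∞` regression in a box around a given point. -/
def solver : Prog :=
  .seq findCols <| .seq scaleMatrix <| .seq computeOffsets <| .seq countRounds <|
  .seq initStrategies <| .seq (forLoop 4 3 iteration) <|
  fill 3 1 (.add (.cell 2) (.mul (.var 0) (.div (.cell 11) (.ofNat (.var 3)))))

section Norm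

variable {n m : ℕ} (A : Matrix (Fin n) (Fin m) ℝ)

theorem row_sum_le_norm (i : Fin n) : ∑ j, |A i j| ≤ ‖A‖ := by
  rw [Matrix.linfty_opNorm_def]
  have := Finset.le_sup (f := fun i => ∑ j, ‖A i j‖₊) (Finset.mem_univ i)
  simpa using NNReal.coe_le_coe.2 this

theorem norm_le_of_row_sum_le {z : ℝ} (hz : 0 ≤ z) (h : ∀ i, ∑ j, |A i j| ≤ z) : ‖A‖ ≤ z := by
  rw [Matrix.linfty_opNorm_def]
  lift z to NNReal using hz
  refine NNReal.coe_le_coe.2 (Finset.sup_le fun i _ => NNReal.coe_le_coe.1 ?_)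
  simpa using h i

end Norm

/-! ### Correctness and cost of the whole program -/

section Solver

variable {n m : ℕ} {A : Matrix (Fin n) (Fin m) ℝ}

theorem Run.scaleMatrix (D : CSC A) {s₀ : State} (h0 : s₀.nvar 0 = n) (h1 : s₀.nvar 1 = m)
    (h2 : s₀.nvar 2 = D.colPtr m) (hr : s₀.narr 1 = D.rowIdx)
    (hc : D.IsColIdx (s₀.narr 2) (D.colPtr m)) (hv : s₀.rarr 0 = D.val) :
    Run scaleMatrix s₀ (400 * (n + m + D.colPtr m + 1)) (fun s => s.rvar 3 = s₀.rvar 0 * ‖A‖ ∧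
      Ready (fun i j => A i j / ‖A‖) (Sum.elim (fun i => s.rarr 8 i) (fun i => s.rarr 9 i))
        (D.colPtr m) s) := by
  obtain ⟨s₁, t₁, e₁, l₁, h₁⟩ := Run.fillMax (a := 5) (e := .cell 0)
    (f := .sub (.const 0) (.cell 0)) h2 (by decide) (fun k => D.val k) (fun k => -D.val k)
    (fun s hF _ _ => by simp [RExp.eval, NExp.eval, hF.rarr 0 (by decide), hv])
  have F₁ := e₁.frame
  obtain ⟨s₂, t₂, e₂, l₂, h₂⟩ := Run.fill (a := 6) (e := .const 0) (b := 0) (N := n)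
    ((F₁.nvar 0 (by decide)).trans h0) (by decide) (fun _ => 0)
    (fun s _ _ _ => by simp [RExp.eval, NExp.eval])
  have F₂ := e₂.frame
  obtain ⟨s₃, t₃, e₃, l₃, h₃⟩ := Run.scatter (a := 6) (c := 1) (e := .cell 5) (N := D.colPtr m)
    (by rw [F₂.nvar 2 (by decide), F₁.nvar 2 (by decide), h2]) (fun k => |D.val k|)
    (fun s hF hk => by
      simp only [RExp.eval, NExp.eval, hF.rarr 5 (by decide), F₂.rarr 5 (by decide), h₁ _ hk]; rfl)
  have F₃ := e₃.frame
  have hsum : ∀ i : Fin n, s₃.rarr 6 i = ∑ j, |A i j| := fun i => by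
    rw [h₃, h₂ _ i.2, F₂.narr 1 (by decide), F₁.narr 1 (by decide), hr,
      D.sum_entries hc (fun i' _ v => if i' = i then |v| else 0) (by simp), Finset.sum_comm,
      zero_add]
    exact Finset.sum_congr rfl fun j _ => by simp [Fin.val_inj]
  obtain ⟨s₄, t₄, e₄, l₄, h₄, h₄'⟩ := Run.maximum (z := 2) (b := 0) (a := 6) (N := n)
    (s₀ := s₃) (by rw [F₃.nvar 0 (by decide), F₂.nvar 0 (by decide), F₁.nvar 0 (by decide), h0])
    (by decide)
  have F₄ := e₄.frame
  have hL : s₄.rvar 2 = ‖A‖ := by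
    have hle : s₄.rvar 2 ≤ ‖A‖ := by
      rcases h₄' with h | ⟨k, hk, h⟩
      · rw [h]; exact norm_nonneg A
      · rw [h, hsum ⟨k, hk⟩]; exact row_sum_le_norm A _
    refine le_antisymm hle (norm_le_of_row_sum_le A ?_ fun i => (hsum i).symm.trans_le (h₄ i i.2))
    rcases h₄' with h | ⟨k, hk, h⟩
    · exact h.ge
    · rw [h, hsum ⟨k, hk⟩]; exact Finset.sum_nonneg fun _ _ => abs_nonneg _
  obtain ⟨s₅, t₅, e₅, l₅, h₅⟩ := Run.fill (a := 4) (b := 2) (e := .div (.cell 0) (.var 2))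
    (N := D.colPtr m) (s₀ := s₄)
    (by rw [F₄.nvar 2 (by decide), F₃.nvar 2 (by decide), F₂.nvar 2 (by decide),
      F₁.nvar 2 (by decide), h2])
    (by decide) (fun k => D.val k / ‖A‖) (fun s hF _ _ => by
      simp only [RExp.eval, NExp.eval, hF.rarr 0 (by decide), hF.rvar 2 (by decide), hL,
        F₄.rarr 0 (by decide), F₃.rarr 0 (by decide), F₂.rarr 0 (by decide),
        F₁.rarr 0 (by decide), hv])
  have F₅ := e₅.frame
  have hN₅ : s₅.nvar 2 = D.colPtr m := by
    rw [F₅.nvar 2 (by decide), F₄.nvar 2 (by decide), F₃.nvar 2 (by decide),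
      F₂.nvar 2 (by decide), F₁.nvar 2 (by decide), h2]
  obtain ⟨s₆, t₆, e₆, l₆, h₆⟩ := Run.fill (a := 5) (b := 2) (e := .div (.cell 5) (.var 2)) hN₅
    (by decide) (fun k => |D.val k| / ‖A‖) (fun s hF hk he => by
      simp only [RExp.eval, NExp.eval, he, hF.rvar 2 (by decide), F₅.rvar 2 (by decide), hL,
        F₅.rarr 5 (by decide), F₄.rarr 5 (by decide), F₃.rarr 5 (by decide),
        F₂.rarr 5 (by decide), h₁ _ hk]; rfl)
  have F₆ := e₆.frame
  set s₇ := s₆.rset 3 (RExp.eval s₆ (.mul (.var 0) (.var 2))) with hs₇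
  have e₇ : Exec (.rset 3 (.mul (.var 0) (.var 2))) s₆ s₇ 4 := Exec.rset _ _ _
  have F₇ := e₇.frame
  refine ⟨s₇, _, e₁.seq (e₂.seq (e₃.seq (e₄.seq (e₅.seq (e₆.seq e₇))))), ?_, ?_, ?_⟩
  · simp only [RExp.cost, NExp.cost] at l₁ l₂ l₃ l₄ l₅ l₆
    omega
  · simp only [hs₇, State.rset, RExp.eval, Function.update_self]
    rw [F₆.rvar 2 (by decide), F₅.rvar 2 (by decide), hL, F₆.rvar 0 (by decide),
      F₅.rvar 0 (by decide), F₄.rvar 0 (by decide), F₃.rvar 0 (by decide), F₂.rvar 0 (by decide),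
      F₁.rvar 0 (by decide)]
  -- The offsets are not computed yet; `Ready` is stated with whatever arrays `8` and `9` contain.
  · refine ⟨?_, ?_, ?_, ?_, ?_, fun _ => rfl, fun _ => rfl⟩
    · rw [F₇.nvar 0 (by decide), F₆.nvar 0 (by decide), F₅.nvar 0 (by decide),
        F₄.nvar 0 (by decide), F₃.nvar 0 (by decide), F₂.nvar 0 (by decide),
        F₁.nvar 0 (by decide), h0]
    · rw [F₇.nvar 1 (by decide), F₆.nvar 1 (by decide), F₅.nvar 1 (by decide),
        F₄.nvar 1 (by decide), F₃.nvar 1 (by decide), F₂.nvar 1 (by decide),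
        F₁.nvar 1 (by decide), h1]
    · rw [F₇.nvar 2 (by decide), F₆.nvar 2 (by decide), hN₅]
    · intro g hg
      have r1 : s₇.narr 1 = D.rowIdx := by
        rw [F₇.narr 1 (by decide), F₆.narr 1 (by decide), F₅.narr 1 (by decide),
          F₄.narr 1 (by decide), F₃.narr 1 (by decide), F₂.narr 1 (by decide),
          F₁.narr 1 (by decide), hr]
      have r2 : s₇.narr 2 = s₀.narr 2 := by
        rw [F₇.narr 2 (by decide), F₆.narr 2 (by decide), F₅.narr 2 (by decide),
          F₄.narr 2 (by decide), F₃.narr 2 (by decide), F₂.narr 2 (by decide),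
          F₁.narr 2 (by decide)]
      rw [← D.sum_entries hc (fun i j v => g i j (v / ‖A‖)) (by simp [hg]), r1, r2]
      refine Finset.sum_congr rfl fun k hk => ?_
      rw [F₇.rarr 4 (by decide), F₆.rarr 4 (by decide), h₅ k (Finset.mem_range.1 hk)]
    · intro k hk
      rw [F₇.rarr 5 (by decide), h₆ k hk, F₇.rarr 4 (by decide), F₆.rarr 4 (by decide), h₅ k hk,
        abs_div, abs_of_nonneg (norm_nonneg A)]

variable {B : Matrix (Fin n) (Fin m) ℝ} {N : ℕ}

theorem Run.computeOffsets (hn : 0 < n) {d₀ : Fin n ⊕ Fin n → ℝ} {s₀ : State}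
    (h : Ready B d₀ N s₀) {b : Fin n → ℝ} {x₀ : Fin m → ℝ} (hb : ∀ i : Fin n, s₀.rarr 1 i = b i)
    (hx : ∀ j : Fin m, s₀.rarr 2 j = x₀ j) :
    let b' : Fin n → ℝ := fun i => b i / s₀.rvar 3 - (B *ᵥ x₀) i / s₀.rvar 0
    Run computeOffsets s₀ (300 * (n + m + N + 1)) (fun s => ∃ β, Ready B (offsets b' β) N s ∧
      (∀ i, |b' i| ≤ β) ∧ ∃ i, |b' i| = β) := by
  intro b'
  obtain ⟨s₁, t₁, e₁, l₁, h₁⟩ := Run.fill (a := 7) (e := .div (.cell 1) (.var 3)) h.rows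
    (by decide) (fun i => s₀.rarr 1 i / s₀.rvar 3) (fun s hF _ _ => by
      simp [RExp.eval, NExp.eval, hF.rarr 1 (by decide), hF.rvar 3 (by decide)])
  have F₁ := e₁.frame
  have R₁ := h.of_frame F₁ (by decide) (by decide) (by decide)
  obtain ⟨s₂, t₂, e₂, l₂, h₂⟩ := Run.scatter (a := 7) (c := 1)
    (e := .div (.mul (.sub (.const 0) (.cell 4)) (.get 2 .col)) (.var 0)) R₁.entries
    (fun k => -s₁.rarr 4 k * s₀.rarr 2 (s₁.narr 2 k) / s₀.rvar 0) (fun s hF _ => by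
      simp [RExp.eval, NExp.eval, hF.rarr 2 (by decide), hF.rarr 4 (by decide),
        hF.rvar 0 (by decide), hF.narr 2 (by decide), F₁.rarr 2 (by decide),
        F₁.rvar 0 (by decide)])
  have F₂ := e₂.frame
  have R₂ := R₁.of_frame F₂ (by decide) (by decide) (by decide)
  have hb' : ∀ i : Fin n, s₂.rarr 7 i = b' i := fun i => by
    rw [h₂, h₁ _ i.2, hb, R₁.sum_row (fun j v => -v * s₀.rarr 2 j / s₀.rvar 0) (by simp)]
    simp only [b', Matrix.mulVec, dotProduct, hx, ← Finset.sum_div, neg_mul,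
      Finset.sum_neg_distrib]
    ring
  obtain ⟨s₃, t₃, e₃, l₃, h₃⟩ := Run.fillMax (a := 6) (e := .cell 7)
    (f := .sub (.const 0) (.cell 7)) R₂.rows (by decide) (fun i => s₂.rarr 7 i)
    (fun i => -s₂.rarr 7 i) (fun s hF _ _ => by
      simp [RExp.eval, NExp.eval, hF.rarr 7 (by decide)])
  have F₃ := e₃.frame
  have R₃ := R₂.of_frame F₃ (by decide) (by decide) (by decide)
  have habs : ∀ i : Fin n, s₃.rarr 6 i = |b' i| := fun i => by rw [h₃ _ i.2, hb']; rfl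
  obtain ⟨s₄, t₄, e₄, l₄, h₄, h₄'⟩ := Run.maximum (z := 4) (a := 6) R₃.rows (by decide)
  have F₄ := e₄.frame
  have R₄ := R₃.of_frame F₄ (by decide) (by decide) (by decide)
  obtain ⟨s₅, t₅, e₅, l₅, h₅⟩ := Run.fillMax (a := 8)
    (e := .sub (.sub (.const 0) (.cell 7)) (.var 4)) (f := .sub (.const 0) (.const 2)) R₄.rows
    (by decide) (fun i => -s₂.rarr 7 i - s₄.rvar 4) (fun _ => -2) (fun s hF _ _ => by
      simp [RExp.eval, NExp.eval, hF.rarr 7 (by decide), hF.rvar 4 (by decide),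
        F₄.rarr 7 (by decide), F₃.rarr 7 (by decide)])
  have F₅ := e₅.frame
  have hr₅ : s₅.nvar 0 = n := (F₅.nvar 0 (by decide)).trans R₄.rows
  obtain ⟨s₆, t₆, e₆, l₆, h₆⟩ := Run.fillMax (a := 9)
    (e := .sub (.cell 7) (.var 4)) (f := .sub (.const 0) (.const 2)) hr₅
    (by decide) (fun i => s₂.rarr 7 i - s₄.rvar 4) (fun _ => -2) (fun s hF _ _ => by
      simp [RExp.eval, NExp.eval, hF.rarr 7 (by decide), hF.rvar 4 (by decide),
        F₅.rarr 7 (by decide), F₅.rvar 4 (by decide), F₄.rarr 7 (by decide),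
        F₃.rarr 7 (by decide)])
  have F₆ := e₆.frame
  refine ⟨s₆, _, e₁.seq (e₂.seq (e₃.seq (e₄.seq (e₅.seq e₆)))), ?_, s₄.rvar 4, ?_, ?_, ?_⟩
  · simp only [RExp.cost, NExp.cost] at l₁ l₂ l₃ l₅ l₆
    omega
  · refine ⟨(F₆.nvar 0 (by decide)).trans hr₅, ?_, ?_, ?_, ?_, fun i => ?_, fun i => ?_⟩
    · rw [F₆.nvar 1 (by decide), F₅.nvar 1 (by decide), R₄.cols]
    · rw [F₆.nvar 2 (by decide), F₅.nvar 2 (by decide), R₄.entries]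
    · rw [F₆.narr 1 (by decide), F₅.narr 1 (by decide), F₆.narr 2 (by decide),
        F₅.narr 2 (by decide), F₆.rarr 4 (by decide), F₅.rarr 4 (by decide)]
      exact R₄.sum_entries
    · rw [F₆.rarr 5 (by decide), F₅.rarr 5 (by decide), F₆.rarr 4 (by decide),
        F₅.rarr 4 (by decide)]
      exact R₄.abs_entries
    · rw [F₆.rarr 8 (by decide), h₅ _ i.2, hb']; rfl
    · rw [h₆ _ i.2, hb']; rfl
  · exact fun i => (habs i).symm.trans_le (h₄ i i.2)
  -- The running maximum starts at `0`. If it stays there, all `|b' i|` vanish and row `0` attains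
  -- it.
  · rcases h₄' with h | ⟨k, hk, h⟩
    · refine ⟨⟨0, hn⟩, le_antisymm ?_ (h ▸ abs_nonneg _)⟩
      rw [← habs]; exact h₄ 0 hn
    · exact ⟨⟨k, hk⟩, by rw [← habs, h]⟩

/-- The machine cannot round a real to a natural number, so the ceiling is found by counting up.
This takes constant time per future iteration and does not affect the total order. -/
theorem Run.countRounds {s₀ : State} (h0 : s₀.nvar 0 = n) :
    Run countRounds s₀
      (9 * ⌈(30 + 120 * Real.log (2 * n)) * s₀.rvar 3 / s₀.rvar 1⌉₊ + 30)
      (fun s => s.nvar 3 = ⌈(30 + 120 * Real.log (2 * n)) * s₀.rvar 3 / s₀.rvar 1⌉₊) := by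
  set Θ := (30 + 120 * Real.log (2 * n)) * s₀.rvar 3 / s₀.rvar 1 with hΘ
  have hloop := Run.loop (t := .rlt (.ofNat (.var 3)) (.var 5))
    (p := .nset 3 (.add (.var 3) (.lit 1))) (c := 4)
    (fun k s => k ≤ ⌈Θ⌉₊ ∧ s.nvar 3 = k ∧ s.rvar 5 = Θ) ⌈Θ⌉₊ ?_
    (s := (s₀.rset 5 Θ).nset 3 0) (k := 0) (Nat.zero_le _)
    ⟨Nat.zero_le _, by simp [State.nset], by simp [State.nset, State.rset]⟩
  · obtain ⟨s', t, he, ht, h1, k, h2, h3, h4⟩ := hloop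
    have e₁ := Exec.rset s₀ 5 (.div (.mul (.add (.const 30) (.mul (.const 120)
      (.log (.mul (.const 2) (.ofNat (.var 0)))))) (.var 3)) (.var 1))
    have hev : RExp.eval s₀ (.div (.mul (.add (.const 30) (.mul (.const 120)
      (.log (.mul (.const 2) (.ofNat (.var 0)))))) (.var 3)) (.var 1)) = Θ := by
      simp [RExp.eval, NExp.eval, h0, hΘ]
    rw [hev] at e₁
    refine ⟨s', _, e₁.seq ((Exec.nset _ 3 (.lit 0)).seq he), ?_, ?_⟩
    · simp only [RExp.cost, NExp.cost, Test.cost] at ht ⊢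
      omega
    · simp only [Test.Holds, RExp.eval, NExp.eval, h3, h4, not_lt] at h1
      exact h3.trans (le_antisymm h2 (Nat.ceil_le.2 h1))
  · rintro k s ⟨-, h2, h3⟩ ht
    simp only [Test.Holds, RExp.eval, NExp.eval, h2, h3] at ht
    have hk := Nat.lt_ceil.2 ht
    refine ⟨hk, Run.nset ⟨hk, ?_, by simp [State.nset, h3]⟩⟩
    simp [State.nset, NExp.eval, h2]

theorem Run.initStrategies {d : Fin n ⊕ Fin n → ℝ} {s₀ : State} (h : Ready B d N s₀) :
    Run initStrategies s₀ (200 * (n + m + N + 1)) (Stores (play (signedRows B) d 0)) := by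
  obtain ⟨s₁, t₁, e₁, l₁, h₁⟩ := Run.fill (a := 10) (e := .const 0) h.cols (by decide)
    (fun _ => 0) (fun s _ _ _ => by simp [RExp.eval, NExp.eval])
  have F₁ := e₁.frame
  have R₁ := h.of_frame F₁ (by decide) (by decide) (by decide)
  obtain ⟨s₂, t₂, e₂, l₂, h₂⟩ := Run.fill (a := 11) (e := .const 0) R₁.cols (by decide)
    (fun _ => 0) (fun s _ _ _ => by simp [RExp.eval, NExp.eval])
  have F₂ := e₂.frame
  have R₂ := R₁.of_frame F₂ (by decide) (by decide) (by decide)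
  obtain ⟨s₃, t₃, e₃, l₃, h₃⟩ := Run.fill (a := 12)
    (e := .div (.const 1) (.mul (.const 2) (.ofNat (.var 0)))) R₂.rows (by decide)
    (fun _ => 1 / (2 * n)) (fun s hF _ _ => by
      simp [RExp.eval, NExp.eval, hF.nvar 0 (by decide), R₂.rows])
  have F₃ := e₃.frame
  have R₃ := R₂.of_frame F₃ (by decide) (by decide) (by decide)
  obtain ⟨s₄, t₄, e₄, l₄, h₄⟩ := Run.fill (a := 13)
    (e := .div (.const 1) (.mul (.const 2) (.ofNat (.var 0)))) R₃.rows (by decide)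
    (fun _ => 1 / (2 * n)) (fun s hF _ _ => by
      simp [RExp.eval, NExp.eval, hF.nvar 0 (by decide), R₃.rows])
  have F₄ := e₄.frame
  have R₄ := R₃.of_frame F₄ (by decide) (by decide) (by decide)
  obtain ⟨s₅, t₅, e₅, l₅, h₅⟩ := Run.fill (a := 14) (e := .const 0) R₄.rows (by decide)
    (fun _ => 0) (fun s _ _ _ => by simp [RExp.eval, NExp.eval])
  have F₅ := e₅.frame
  have R₅ := R₄.of_frame F₅ (by decide) (by decide) (by decide)
  obtain ⟨s₆, t₆, e₆, l₆, h₆⟩ := Run.fill (a := 15) (e := .const 0) R₅.rows (by decide)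
    (fun _ => 0) (fun s _ _ _ => by simp [RExp.eval, NExp.eval])
  have F₆ := e₆.frame
  have hsm : ∀ i, softmax (0 : Fin n ⊕ Fin n → ℝ) i = 1 / (2 * n) := fun i => by
    simp [softmax, two_mul]
  refine ⟨s₆, _, e₁.seq (e₂.seq (e₃.seq (e₄.seq (e₅.seq e₆)))), ?_, fun j => ?_, fun j => ?_,
    fun i => ?_, fun i => ?_, fun i => ?_, fun i => ?_⟩
  · simp only [RExp.cost, NExp.cost] at l₁ l₂ l₃ l₄ l₅ l₆
    omega
  · rw [F₆.rarr 10 (by decide), F₅.rarr 10 (by decide), F₄.rarr 10 (by decide),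
      F₃.rarr 10 (by decide), F₂.rarr 10 (by decide), h₁ _ j.2]; rfl
  · rw [F₆.rarr 11 (by decide), F₅.rarr 11 (by decide), F₄.rarr 11 (by decide),
      F₃.rarr 11 (by decide), h₂ _ j.2]; rfl
  · rw [F₆.rarr 12 (by decide), F₅.rarr 12 (by decide), F₄.rarr 12 (by decide), h₃ _ i.2]
    exact (hsm _).symm
  · rw [F₆.rarr 13 (by decide), F₅.rarr 13 (by decide), h₄ _ i.2]
    exact (hsm _).symm
  · rw [F₆.rarr 14 (by decide), h₅ _ i.2]; rfl
  · rw [h₆ _ i.2]; rfl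

theorem Run.iterations {d : Fin n ⊕ Fin n → ℝ} {s₀ : State} (h : Ready B d N s₀)
    (hP : Stores (play (signedRows B) d 0) s₀) :
    Run (LinfReg.forLoop 4 3 LinfReg.iteration) s₀
      (s₀.nvar 3 * (600 * (n + m + N + 1) + 8) + 6)
      (Stores (play (signedRows B) d (s₀.nvar 3))) := by
  refine Run.forLoop (fun t s => Stores (play (signedRows B) d t) s) (by decide) (by decide)
    (by decide) ⟨hP.x, hP.X, hP.y_inl, hP.y_inr, hP.Y_inl, hP.Y_inr⟩ ?_
  rintro t - s rfl hF hs
  have R := h.of_frame hF (by decide) (by decide) (by decide)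
  exact (Run.iteration R hs).mono le_rfl fun s' _ hs' =>
    ⟨hs'.x, hs'.X, hs'.y_inl, hs'.y_inr, hs'.Y_inl, hs'.Y_inr⟩

/-- The result of the method solves the regression problem. -/
theorem regression_solution (hA : 0 < ‖A‖) {b : Fin n → ℝ} {r ε : ℝ} (hr : 0 < r)
    (hε : 0 < ε) {x₀ : Fin m → ℝ} {β : ℝ} {b' : Fin n → ℝ}
    (hb' : b' = fun i => b i / (r * ‖A‖) - (Matrix.of (fun i j => A i j / ‖A‖) *ᵥ x₀) i / r)
    (hβ : ∀ i, |b' i| ≤ β) (hβ' : ∃ i, |b' i| = β) {T : ℕ} (hT : 0 < T)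
    (hTε : (30 + 120 * Real.log (2 * n)) * (r * ‖A‖) / ε ≤ T) {x : Fin m → ℝ}
    (hx : ∀ j, x j = x₀ j
      + r * ((play (signedRows (Matrix.of fun i j => A i j / ‖A‖)) (offsets b' β) T).X j / T)) :
    (∀ j, |x j - x₀ j| ≤ r) ∧
      ∀ y : Fin m → ℝ, (∀ j, |y j - x₀ j| ≤ r) → ‖A *ᵥ x - b‖ ≤ ‖A *ᵥ y - b‖ + ε := by
  set B : Matrix (Fin n) (Fin m) ℝ := Matrix.of fun i j => A i j / ‖A‖ with hBdef
  have hT' : (0 : ℝ) < T := by exact_mod_cast hT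
  have hB : ∀ i, ∑ j, |B i j| ≤ 1 := fun i => by
    simp only [hBdef, Matrix.of_apply, abs_div, ← Finset.sum_div, abs_of_pos hA]
    exact (div_le_one hA).2 (row_sum_le_norm A i)
  have hAB : A = ‖A‖ • B := by
    ext i j; simp only [hBdef, Matrix.smul_apply, Matrix.of_apply, smul_eq_mul]; field_simp
  have hscale : ∀ u : Fin m → ℝ,
      A *ᵥ (x₀ + r • u) - b = (r * ‖A‖) • (B *ᵥ u - b') := fun u => by
    funext i
    have e : ∀ w : Fin m → ℝ, (A *ᵥ w) i = ‖A‖ * (B *ᵥ w) i := fun w => by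
      conv_lhs => rw [hAB]
      rw [Matrix.smul_mulVec, Pi.smul_apply, smul_eq_mul]
    rw [Pi.sub_apply, e, Matrix.mulVec_add, Matrix.mulVec_smul]
    simp only [hb', Pi.add_apply, Pi.smul_apply, Pi.sub_apply, smul_eq_mul]
    field_simp
    ring
  have hnorm : ∀ u : Fin m → ℝ, ‖A *ᵥ (x₀ + r • u) - b‖ = r * ‖A‖ * ‖B *ᵥ u - b'‖ := fun u => by
    rw [hscale, norm_smul, Real.norm_of_nonneg (by positivity)]
  set u : Fin m → ℝ := fun j => (play (signedRows B) (offsets b' β) T).X j / T with hu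
  have hxu : x = x₀ + r • u := funext hx
  refine ⟨fun j => ?_, fun y hy => ?_⟩
  · rw [hx j, add_sub_cancel_left, abs_mul, abs_of_pos hr, abs_div, abs_of_pos hT']
    exact mul_le_of_le_one_right hr.le ((div_le_one hT').2 (abs_play_X_le _ _ T j))
  · set v : Fin m → ℝ := fun j => (y j - x₀ j) / r with hv
    have hyv : y = x₀ + r • v := by
      funext j; simp only [hv, Pi.add_apply, Pi.smul_apply, smul_eq_mul]; field_simp; ring
    have hgap := regression_gap hB hβ hβ' (v := v) (fun j => by
      rw [hv, abs_div, abs_of_pos hr]; exact (div_le_one hr).2 (hy j)) hT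
    rw [hxu, hyv, hnorm, hnorm]
    -- The number of rounds is chosen so that the game's error, scaled back by `r * ‖A‖`, is at most
    -- `ε`.
    have h1 : r * ‖A‖ * ((30 + 120 * Real.log (2 * n)) / T) ≤ ε := by
      rw [div_le_iff₀ hε] at hTε
      rw [← mul_div_assoc, div_le_iff₀ hT']
      linarith
    have h2 := mul_le_mul_of_nonneg_left hgap (by positivity : 0 ≤ r * ‖A‖)
    rw [mul_add] at h2
    linarith

/-- The number of iterations. -/
noncomputable def rounds (A : Matrix (Fin n) (Fin m) ℝ) (r ε : ℝ) : ℕ :=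
  ⌈(30 + 120 * Real.log (2 * n)) * (r * ‖A‖) / ε⌉₊

theorem Run.solver (D : CSC A) (b : Fin n → ℝ) {r ε : ℝ} (x₀ : Fin m → ℝ) (hn : 0 < n)
    (hA : 0 < ‖A‖) (hr : 0 < r) (hε : 0 < ε) (ω : ℕ → unitInterval) :
    Run solver (initState D b r ε x₀ ω) (3000 * (n + m + nnz A + 1) * (rounds A r ε + 1))
      (fun s => (∀ j, |output m s j - x₀ j| ≤ r) ∧
        ∀ y : Fin m → ℝ, (∀ j, |y j - x₀ j| ≤ r) →
          ‖A *ᵥ output m s - b‖ ≤ ‖A *ᵥ y - b‖ + ε) := by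
  set s₀ := initState D b r ε x₀ ω with hs₀
  obtain ⟨s₁, t₁, e₁, l₁, h₁, h₁'⟩ := Run.findCols D (s₀ := s₀) rfl rfl
  have F₁ := e₁.frame
  rw [← D.colPtr_eq_nnz h₁']
  obtain ⟨s₂, t₂, e₂, l₂, h₂, R₂⟩ := Run.scaleMatrix D (s₀ := s₁) (F₁.nvar 0 (by decide))
    (F₁.nvar 1 (by decide)) h₁ (F₁.narr 1 (by decide)) h₁' (F₁.rarr 0 (by decide))
  have F₂ := e₂.frame
  obtain ⟨s₃, t₃, e₃, l₃, β, R₃, hβ, hβ'⟩ := Run.computeOffsets hn R₂ (b := b) (x₀ := x₀)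
    (fun i => by rw [F₂.rarr 1 (by decide), F₁.rarr 1 (by decide)]; simp [hs₀, initState, pad])
    (fun j => by rw [F₂.rarr 2 (by decide), F₁.rarr 2 (by decide)]; simp [hs₀, initState, pad])
  have F₃ := e₃.frame
  obtain ⟨s₄, t₄, e₄, l₄, h₄⟩ := Run.countRounds R₃.rows
  have F₄ := e₄.frame
  have R₄ := R₃.of_frame F₄ (by decide) (by decide) (by decide)
  obtain ⟨s₅, t₅, e₅, l₅, h₅⟩ := Run.initStrategies R₄
  have F₅ := e₅.frame
  have R₅ := R₄.of_frame F₅ (by decide) (by decide) (by decide)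
  obtain ⟨s₆, t₆, e₆, l₆, h₆⟩ := Run.iterations R₅ h₅
  have F₆ := e₆.frame
  have R₆ := R₅.of_frame F₆ (by decide) (by decide) (by decide)
  obtain ⟨s₇, t₇, e₇, l₇, h₇⟩ := Run.fill (a := 3)
    (e := .add (.cell 2) (.mul (.var 0) (.div (.cell 11) (.ofNat (.var 3))))) R₆.cols (by decide)
    (fun j => s₆.rarr 2 j + s₆.rvar 0 * (s₆.rarr 11 j / s₆.nvar 3)) (fun s hF _ _ => by
      simp [RExp.eval, NExp.eval, hF.rarr 2 (by decide), hF.rarr 11 (by decide),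
        hF.rvar 0 (by decide), hF.nvar 3 (by decide)])
  have hr₁ : s₁.rvar 0 = r := F₁.rvar 0 (by decide)
  have hr₂ : s₂.rvar 0 = r := (F₂.rvar 0 (by decide)).trans hr₁
  rw [hr₁] at h₂
  have hS : s₃.rvar 3 = r * ‖A‖ := (F₃.rvar 3 (by decide)).trans h₂
  have hE : s₃.rvar 1 = ε := by
    rw [F₃.rvar 1 (by decide), F₂.rvar 1 (by decide), F₁.rvar 1 (by decide)]; rfl
  have hT : ⌈(30 + 120 * Real.log (2 * n)) * s₃.rvar 3 / s₃.rvar 1⌉₊ = rounds A r ε := by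
    rw [hS, hE]; rfl
  rw [hT] at h₄ l₄
  have hT₅ : s₅.nvar 3 = rounds A r ε := (F₅.nvar 3 (by decide)).trans h₄
  have hT₆ : s₆.nvar 3 = rounds A r ε := (F₆.nvar 3 (by decide)).trans hT₅
  rw [hT₅] at h₆ l₆
  have hr₆ : s₆.rvar 0 = r := by
    rw [F₆.rvar 0 (by decide), F₅.rvar 0 (by decide), F₄.rvar 0 (by decide),
      F₃.rvar 0 (by decide), hr₂]
  have hx₆ : ∀ j : Fin m, s₆.rarr 2 j = x₀ j := fun j => by
    rw [F₆.rarr 2 (by decide), F₅.rarr 2 (by decide), F₄.rarr 2 (by decide),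
      F₃.rarr 2 (by decide), F₂.rarr 2 (by decide), F₁.rarr 2 (by decide)]
    simp [hs₀, initState, pad]
  have hlog : 0 ≤ Real.log (2 * n) := Real.log_nonneg (by
    have : (1 : ℝ) ≤ n := by exact_mod_cast hn
    linarith)
  refine ⟨s₇, _, e₁.seq (e₂.seq (e₃.seq (e₄.seq (e₅.seq (e₆.seq e₇))))), ?_, ?_⟩
  · simp only [RExp.cost, NExp.cost] at l₇
    nlinarith [Nat.zero_le (rounds A r ε * (n + m + D.colPtr m))]
  · refine regression_solution hA hr hε ?_ hβ hβ' (T := rounds A r ε)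
      (Nat.ceil_pos.2 (by positivity)) (Nat.le_ceil _) fun j => ?_
    · rw [hr₂, h₂]; rfl
    · rw [output, h₇ _ j.2, hx₆, hr₆, h₆.X, hT₆]; rfl

end Solver

/-! ### Running time -/

section Time

variable {n m c : ℕ} {A : Matrix (Fin n) (Fin m) ℝ}

/-- Justifies dividing the matrix by its norm. -/
theorem norm_pos_of_nnz_pos (h : 0 < nnz A) : 0 < ‖A‖ := by
  refine (norm_nonneg A).lt_of_ne' fun h0 => h.ne' ?_
  have h1 : ∀ i j, A i j = 0 := fun i j => by
    have h2 := Finset.single_le_sum (fun j _ => abs_nonneg (A i j)) (Finset.mem_univ j)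
    have h3 := h2.trans (row_sum_le_norm A i)
    rw [h0] at h3
    exact abs_nonpos_iff.1 h3
  simp [nnz, colNnz, h1]

theorem nnz_le (hc : ∀ j, colNnz A j ≤ c) : nnz A ≤ m * c := by
  simpa [nnz] using Finset.sum_le_card_nsmul Finset.univ (colNnz A) c fun j _ => hc j

theorem time_le_softBound (hn : 0 < n) (hnnz : n ≤ nnz A) (hc : ∀ j, colNnz A j ≤ c) {r ε : ℝ}
    (hr : 0 < r) (hε : 0 < ε) :
    ((3000 * (n + m + nnz A + 1) * (rounds A r ε + 1) : ℕ) : ℝ)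
      ≤ softBound 4000000 1 (m * c * max 1 (r * ‖A‖ / ε)) := by
  have hle := nnz_le hc
  have hmc : m ≤ m * c := by
    refine Nat.le_mul_of_pos_right m (Nat.pos_of_ne_zero fun h => ?_)
    rw [h, mul_zero] at hle
    omega
  -- Each summand is at most `m * c`: `1 ≤ n ≤ nnz A ≤ m * c`, and `c ≥ 1` gives `m ≤ m * c`.
  have hsize : n + m + nnz A + 1 ≤ 4 * (m * c) := by omega
  have hsize' : ((n + m + nnz A + 1 : ℕ) : ℝ) ≤ 4 * (m * c) := by exact_mod_cast hsize
  have hn' : (1 : ℝ) ≤ n := by exact_mod_cast hn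
  have hnmc : (n : ℝ) ≤ m * c := by exact_mod_cast hnnz.trans hle
  set q := max 1 (r * ‖A‖ / ε) with hq
  have hq1 : 1 ≤ q := le_max_left _ _
  have hq2 : r * ‖A‖ / ε ≤ q := le_max_right _ _
  set f : ℝ := m * c * q with hf
  have hfn : (n : ℝ) ≤ f := hnmc.trans (le_mul_of_one_le_right (by linarith) hq1)
  set l := Real.log (2 + f) with hl
  have hl1 : 1 ≤ l := by
    rw [hl, Real.le_log_iff_exp_le (by linarith)]
    linarith [Real.exp_one_lt_d9]
  -- From `n ≤ f` one gets `2 * n ≤ (2 + f) ^ 2`, so a single logarithm of `f` covers the `log n` of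
  -- the method.
  have hl2 : Real.log (2 * n) ≤ 2 * l := by
    rw [hl, show 2 * Real.log (2 + f) = Real.log ((2 + f) ^ 2) by rw [Real.log_pow]; norm_num]
    exact Real.log_le_log (by linarith) (by nlinarith)
  have hlog : 0 ≤ Real.log (2 * n) := Real.log_nonneg (by linarith)
  -- With `l ≥ 1`, `30 + 120 * (2 * l)` is at most `270 * l`; rounding up and the extra `1` cost at
  -- most `2 * l * q`.
  have hT : (rounds A r ε : ℝ) + 1 ≤ 272 * l * q := by
    have h1 := Nat.ceil_lt_add_one (a := (30 + 120 * Real.log (2 * n)) * (r * ‖A‖) / ε)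
      (by positivity)
    have h2 : (30 + 120 * Real.log (2 * n)) * (r * ‖A‖) / ε ≤ (270 * l) * q := by
      rw [mul_div_assoc]
      exact mul_le_mul (by linarith) hq2 (by positivity) (by positivity)
    have h3 : 1 ≤ l * q := one_le_mul_of_one_le_of_one_le hl1 hq1
    unfold rounds
    linarith
  calc ((3000 * (n + m + nnz A + 1) * (rounds A r ε + 1) : ℕ) : ℝ)
      = 3000 * ((n + m + nnz A + 1 : ℕ) : ℝ) * ((rounds A r ε : ℝ) + 1) := by push_cast; ring
    _ ≤ 3000 * (4 * (m * c)) * (272 * l * q) := by gcongr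
    _ = 3264000 * f * l := by rw [hf]; ring
    _ ≤ 4000000 * f * l := by
        have : 0 ≤ f * l := mul_nonneg (by linarith) (by linarith)
        linarith
    _ = softBound 4000000 1 f := by rw [softBound, pow_one]

/-- Success on every outcome makes the failure set empty, so any `δ`, hence any `K`, is allowed. -/
theorem Run.solvesWithin {p : Prog} {init : (ℕ → unitInterval) → State} {T : ℕ} {T' : ℝ}
    {δ : ENNReal} {Good : State → Prop} (h : ∀ ω, Run p (init ω) T Good) (hT : (T : ℝ) ≤ T') :
    SolvesWithin p init T' δ Good := by
  constructor
  · intro ω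
    obtain ⟨s', t, he, ht, -⟩ := h ω
    exact ⟨s', t, he, (Nat.cast_le.2 ht).trans hT⟩
  · have : {ω | ¬ ∃ s' t, Exec p (init ω) s' t ∧ Good s'} = ∅ := by
      refine Set.eq_empty_of_forall_notMem fun ω hω => hω ?_
      obtain ⟨s', t, he, -, hg⟩ := h ω
      exact ⟨s', t, he, hg⟩
    rw [this, measure_empty]
    exact zero_le

end Time

end LinfReg

/-! ### The two algorithms -/

theorem mainTheorem9 (K : ℕ) :
    (∃ (p : LinfReg.Prog) (C : ℝ) (k : ℕ),
      ∀ (n m c : ℕ) (A : Matrix (Fin n) (Fin m) ℝ) (D : LinfReg.CSC A) (b : Fin n → ℝ) (r ε : ℝ),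
        0 < n → n ≤ LinfReg.nnz A → (∀ j, LinfReg.colNnz A j ≤ c) → 0 < r → 0 < ε →
        LinfReg.SolvesWithin p (LinfReg.initState D b r ε 0)
          (LinfReg.softBound C k (m * c * max 1 (r * ‖A‖ / ε)))
          (ENNReal.ofReal (((n : ℝ) + m) ^ K)⁻¹)
          (fun s => LinfReg.IsApproxMin (fun x : Fin m → ℝ => ‖A *ᵥ x - b‖)
            {x | ∀ j, x j ∈ Set.Icc (-r) r} ε (LinfReg.output m s))) ∧
    (∃ (p : LinfReg.Prog) (C : ℝ) (k : ℕ),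
      ∀ (n m c : ℕ) (A : Matrix (Fin n) (Fin m) ℝ) (D : LinfReg.CSC A) (b : Fin n → ℝ) (r ε : ℝ)
        (x₀ xopt : Fin m → ℝ),
        0 < n → n ≤ LinfReg.nnz A → (∀ j, LinfReg.colNnz A j ≤ c) → 0 < r → 0 < ε →
        IsMinOn (fun x : Fin m → ℝ => ‖A *ᵥ x - b‖) Set.univ xopt → ‖x₀ - xopt‖ ≤ r →
        LinfReg.SolvesWithin p (LinfReg.initState D b r ε x₀)
          (LinfReg.softBound C k (m * c * max 1 (r * ‖A‖ / ε)))
          (ENNReal.ofReal (((n : ℝ) + m) ^ K)⁻¹)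
          (fun s => LinfReg.IsApproxMin (fun x : Fin m → ℝ => ‖A *ᵥ x - b‖)
            Set.univ ε (LinfReg.output m s))) := by
  open LinfReg in
  refine ⟨⟨solver, 4000000, 1, ?_⟩, ⟨solver, 4000000, 1, ?_⟩⟩
  · intro n m c A D b r ε hn hnnz hc hr hε
    have hA := norm_pos_of_nnz_pos (hn.trans_le hnnz)
    refine Run.solvesWithin (fun ω => (Run.solver D b 0 hn hA hr hε ω).mono le_rfl ?_)
      (time_le_softBound hn hnnz hc hr hε)
    rintro s' - ⟨h1, h2⟩
    exact ⟨fun j => abs_le.1 (by simpa using h1 j),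
      fun y hy => h2 y fun j => by simpa using abs_le.2 (hy j)⟩
  · intro n m c A D b r ε x₀ xopt hn hnnz hc hr hε hmin hx
    have hA := norm_pos_of_nnz_pos (hn.trans_le hnnz)
    refine Run.solvesWithin (fun ω => (Run.solver D b x₀ hn hA hr hε ω).mono le_rfl ?_)
      (time_le_softBound hn hnnz hc hr hε)
    rintro s' - ⟨-, h2⟩
    -- The output competes with every point of the box around `x₀`, which contains the global
    -- minimizer `xopt`.
    refine ⟨Set.mem_univ _, fun y hy => (h2 xopt fun j => ?_).trans
      (add_le_add_left (hmin (Set.mem_univ y)) ε)⟩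
    rw [abs_sub_comm]
    exact (norm_le_pi_norm (x₀ - xopt) j).trans hx
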